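/- Let $n\ge 0$, $N=2n$, and let $q\in\mathbb C^\times$ be generic, i.e. not a root of unity; put $q^z=\exp(z\log q)$, $$h(z)=q\,\frac{q^{-2z}-q^{-2}}{q^{-2z}-1},\qquad g(z)=h(z)h(-z).$$ Let $M$ be the field of meromorphic functions on $\mathbb C^N$, let $e_i$ be the standard basis of $\mathbb C^N$ and $(T_\alpha f)(x)=f(x+\alpha)$. *The algebra $\mathscr F=\mathscr F_R(M(N))$.* It is the associative unital $\mathbb C$-algebra generated by $t_{ij}$ ($1\le i,j\le N$) and two commuting copies $\mu_l(f)=f(\lambda)$, $\mu_r(f)=f(\mu)$ ($f\in M$) of $M$, with the relations $f(\lambda)t_{ij}=t_{ij}f(\lambda+e_i)$, $f(\mu)t_{ij}=t_{ij}f(\mu+e_j)$, the relations $h(\mu_k-\mu_l)t_{ik}t_{il}=t_{il}t_{ik}$ for $k<l$, $h(\lambda_j-\lambda_i)t_{jk}t_{ik}=t_{ik}t_{jk}$ for $i<j$, and, for $i<j$ and $k<l$, $$t_{ik}t_{jl}=t_{jl}t_{ik}+\bigl(h(\lambda_j-\lambda_i)-h(\mu_k-\mu_l)\bigr)t_{jk}t_{il},$$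 $$g(\mu_k-\mu_l)t_{ik}t_{jl}=g(\lambda_i-\lambda_j)t_{jl}t_{ik}+\bigl(h(\mu_l-\mu_k)-h(\lambda_i-\lambda_j)\bigr)t_{il}t_{jk},$$ $$g(\mu_k-\mu_l)t_{jk}t_{il}=t_{il}t_{jk}+\bigl(h(\lambda_i-\lambda_j)-h(\mu_k-\mu_l)\bigr)t_{jl}t_{ik}.$$ It is bigraded by $\deg t_{ij}=(e_i,e_j)$, $\deg f(\lambda)=\deg f(\mu)=(0,0)$, with components $\mathscr F_{\alpha\beta}$. For $\sigma\in S_r$ and $I=\{i_1<\dots<i_r\}\subseteq[1,N]$ put $$S(\sigma,I)=\prod_{k<l,\ \sigma(k)>\sigma(l)}\bigl(-h(\lambda_{i_{\sigma(k)}}-\lambda_{i_{\sigma(l)}})\bigr),\qquad \tilde S(\sigma,I)=\prod_{k<l,\ \sigma(k)>\sigma(l)}\bigl(-h(\lambda_{i_{\sigma(l)}}-\lambda_{i_{\sigma(k)}})\bigr).$$ For $|I|=|J|=r$ the dynamical quantum minor is $$\xi^I_J=\mu_r(S(\rho,J)^{-1})\sum_{\sigma\in S_r}\mu_l(S(\sigma,I))\,t_{i_{\sigma(1)}j_{\rho(1)}}\cdots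 t_{i_{\sigma(r)}j_{\rho(r)}},$$ where $\rho\in S_r$ may be chosen arbitrarily, and $\det(T)=\xi^{[1,N]}_{[1,N]}$. *The algebra $\widetilde{\mathcal B}$.* It is the associative unital $\mathbb C$-algebra generated by $\tilde b_{ji}$ ($1\le i<j\le N$) and a copy of $M$, with the relations $f(\lambda)\tilde b_{ji}=\tilde b_{ji}f(\lambda+e_i+e_j)$. It is graded by $\deg\tilde b_{ji}=e_i+e_j$, $\deg f=0$, with components $\widetilde{\mathcal B}_\alpha$. *The tensor product.* $\widetilde{\mathcal B}\,\widetilde\otimes\,\mathscr F$ is $\bigoplus_{\alpha,\beta}\widetilde{\mathcal B}_\alpha\otimes\mathscr F_{\alpha\beta}$ modulo the relations $b\otimes\mu_l(f)t=fb\otimes t$. It is an algebra with product $(b\otimes t)(b'\otimes t')=bb'\otimes tt'$, on which $M$ acts by $f(b\otimes t)=b\otimes\mu_r(f)t$. *The tilde Pfaffian.* For an array $X=(x_{ji})_{i<j}$ in $\widetilde{\mathcal B}$ or in $\widetilde{\mathcal B}\,\widetilde\otimes\,\mathscr F$, $$\widetilde{\mathrm{Pf}}(X)=\sum_{\sigma\in\Pi}\tilde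 S(\sigma,[1,2n])\,x_{\sigma(2n)\sigma(2n-1)}\,x_{\sigma(2n-2)\sigma(2n-3)}\cdots x_{\sigma(2)\sigma(1)},$$ where $\Pi=\{\sigma\in S_{2n}:\sigma(2i-1)<\sigma(2i),\ i=1,\dots,n\}$. **Theorem.** Let $\widetilde B=(\tilde b_{ji})_{i<j}$ and $C=(c_{ji})_{i<j}$ with $c_{ji}=\sum_{k<l}\tilde b_{lk}\otimes\xi^{kl}_{ij}$. Then, for every choice of the permutations $\rho$ used to compute the minors $\xi^{kl}_{ij}$ and $\det(T)$, $$\widetilde{\mathrm{Pf}}(C)=\widetilde{\mathrm{Pf}}(\widetilde B)\otimes\det(T)\quad\text{in }\ \widetilde{\mathcal B}\,\widetilde\otimes\,\mathscr F_R(M(2n)).$$ -/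

import Mathlib

open scoped TensorProduct

noncomputable section

namespace DynPf

/-! ### Meromorphic functions on the dual of the Cartan algebra, identified with `ℂ ^ N` -/

/-- Entire functions on `ℂ ^ N`. -/
def Entire (N : ℕ) : Subalgebra ℂ ((Fin N → ℂ) → ℂ) where
  carrier := {f | Differentiable ℂ f}
  mul_mem' hf hg := Differentiable.mul hf hg
  add_mem' hf hg := Differentiable.add hf hg
  algebraMap_mem' c := differentiable_const c

instance (N : ℕ) : IsDomain (Entire N) := by
  have hnz : NoZeroDivisors (Entire N) := by
    refine ⟨fun {f g} hfg => ?_⟩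
    by_contra! hne
    obtain ⟨hf, hg⟩ := hne
    have hf' : ∃ a, f.1 a ≠ 0 := by
      by_contra! h
      exact hf (Subtype.ext (funext h))
    have hg' : ∃ b, g.1 b ≠ 0 := by
      by_contra! h
      exact hg (Subtype.ext (funext h))
    obtain ⟨a, ha⟩ := hf'
    obtain ⟨b, hb⟩ := hg'
    have hline : Differentiable ℂ (fun z : ℂ => a + z • (b - a)) := by fun_prop
    have hF : AnalyticOnNhd ℂ (fun z : ℂ => f.1 (a + z • (b - a))) Set.univ := fun z _ =>
      Differentiable.analyticAt (Differentiable.comp f.2 hline) z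
    have hG : AnalyticOnNhd ℂ (fun z : ℂ => g.1 (a + z • (b - a))) Set.univ := fun z _ =>
      Differentiable.analyticAt (Differentiable.comp g.2 hline) z
    have key := AnalyticOnNhd.eq_zero_or_eq_zero_of_mul_eq_zero hF hG
      (fun z _ => congrFun (congrArg Subtype.val hfg) (a + z • (b - a)))
      isPreconnected_univ
    rcases key with h | h
    · exact ha (by simpa using h 0 (Set.mem_univ _))
    · exact hb (by simpa using h 1 (Set.mem_univ _))
  exact NoZeroDivisors.to_isDomain _

/-- The field of meromorphic functions on `ℂ ^ N`. Every meromorphic function on `ℂ ^ N` is a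
quotient of two entire functions, so this is the fraction field of the ring of entire functions. -/
abbrev Mer (N : ℕ) : Type := FractionRing (Entire N)

/-- Translation `f(x) ↦ f(x + α)` of entire functions. -/
def shiftEntire {N : ℕ} (α : Fin N → ℂ) : Entire N ≃ₐ[ℂ] Entire N where
  toFun f := ⟨fun x => f.1 (x + α), Differentiable.comp f.2 (differentiable_id.add_const α)⟩
  invFun f := ⟨fun x => f.1 (x - α), Differentiable.comp f.2 (differentiable_id.sub_const α)⟩
  left_inv f := by ext x; simp
  right_inv f := by ext x; simp
  map_mul' _ _ := rfl
  map_add' _ _ := rfl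
  commutes' _ := rfl

/-- The automorphism `T_α` of the field of meromorphic functions, `(T_α f)(x) = f(x + α)`. -/
def T {N : ℕ} (α : Fin N → ℂ) : Mer N ≃ₐ[ℂ] Mer N :=
  IsFractionRing.algEquivOfAlgEquiv (shiftEntire α)

/-- The basis vector `ω(i) = e_i`. -/
def ω {N : ℕ} (i : Fin N) : Fin N → ℂ := Pi.single i 1

/-- The entire function `x ↦ q ^ (-2 (x_i - x_j))`, where `q ^ z = exp (z log q)`. -/
def qpow (q : ℂ) {N : ℕ} (i j : Fin N) : Entire N :=
  ⟨fun x => Complex.exp (-2 * (x i - x j) * Complex.log q), by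
    change Differentiable ℂ _
    fun_prop⟩

/-- The function `h(x_i - x_j)`, where `h(z) = q (q^(-2z) - q^(-2)) / (q^(-2z) - 1)`. -/
def h (q : ℂ) {N : ℕ} (i j : Fin N) : Mer N :=
  algebraMap ℂ (Mer N) q *
    (algebraMap (Entire N) (Mer N) (qpow q i j) - algebraMap ℂ (Mer N) (q⁻¹ ^ 2)) /
      (algebraMap (Entire N) (Mer N) (qpow q i j) - 1)

/-- The function `g(x_i - x_j)`, where `g(z) = h(z) h(-z)`. -/
def g (q : ℂ) {N : ℕ} (i j : Fin N) : Mer N := h q i j * h q j i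

/-- The generalized sign `S(σ, I)`, with `I` given by its increasing enumeration. -/
def S (q : ℂ) {N r : ℕ} (σ : Equiv.Perm (Fin r)) (I : Fin r → Fin N) : Mer N :=
  ∏ p : Fin r × Fin r with p.1 < p.2 ∧ σ p.2 < σ p.1, -h q (I (σ p.1)) (I (σ p.2))

/-- The generalized sign `S̃(σ, I)`, with `I` given by its increasing enumeration. -/
def Stilde (q : ℂ) {N r : ℕ} (σ : Equiv.Perm (Fin r)) (I : Fin r → Fin N) : Mer N :=
  ∏ p : Fin r × Fin r with p.1 < p.2 ∧ σ p.2 < σ p.1, -h q (I (σ p.2)) (I (σ p.1))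

/-! ### The dynamical quantum matrix algebra -/

/-- Generators: two copies of the meromorphic functions and the `t_{ij}`. -/
inductive FGen (N : ℕ) : Type
  | l (f : Mer N)
  | r (f : Mer N)
  | t (i j : Fin N)

namespace FGen

/-- The generator `f(λ)` in the free algebra. -/
abbrev L {N : ℕ} (f : Mer N) : FreeAlgebra ℂ (FGen N) := FreeAlgebra.ι ℂ (FGen.l f)

/-- The generator `f(μ)` in the free algebra. -/
abbrev R {N : ℕ} (f : Mer N) : FreeAlgebra ℂ (FGen N) := FreeAlgebra.ι ℂ (FGen.r f)

/-- The generator `t_{ij}` in the free algebra. -/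
abbrev X {N : ℕ} (i j : Fin N) : FreeAlgebra ℂ (FGen N) := FreeAlgebra.ι ℂ (FGen.t i j)

end FGen

open FGen in
/-- Defining relations of the dynamical quantum matrix algebra. The first eight say that the two
copies of the meromorphic functions are (commuting) homomorphic images of `Mer N`. The last five are
the quadratic relations of the dynamical R-matrix. -/
inductive FRel (q : ℂ) (N : ℕ) : FreeAlgebra ℂ (FGen N) → FreeAlgebra ℂ (FGen N) → Prop
  | l_const (c : ℂ) : FRel q N (L (algebraMap ℂ (Mer N) c)) (algebraMap ℂ _ c)
  | l_add (f₁ f₂ : Mer N) : FRel q N (L (f₁ + f₂)) (L f₁ + L f₂)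
  | l_mul (f₁ f₂ : Mer N) : FRel q N (L (f₁ * f₂)) (L f₁ * L f₂)
  | r_const (c : ℂ) : FRel q N (R (algebraMap ℂ (Mer N) c)) (algebraMap ℂ _ c)
  | r_add (f₁ f₂ : Mer N) : FRel q N (R (f₁ + f₂)) (R f₁ + R f₂)
  | r_mul (f₁ f₂ : Mer N) : FRel q N (R (f₁ * f₂)) (R f₁ * R f₂)
  | lr_comm (f₁ f₂ : Mer N) : FRel q N (L f₁ * R f₂) (R f₂ * L f₁)
  | l_shift (f : Mer N) (i j : Fin N) : FRel q N (L f * X i j) (X i j * L (T (ω i) f))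
  | r_shift (f : Mer N) (i j : Fin N) : FRel q N (R f * X i j) (X i j * R (T (ω j) f))
  | row (i k l : Fin N) (hkl : k < l) :
      FRel q N (R (h q k l) * X i k * X i l) (X i l * X i k)
  | col (i j k : Fin N) (hij : i < j) :
      FRel q N (L (h q j i) * X j k * X i k) (X i k * X j k)
  | cross₁ (i j k l : Fin N) (hij : i < j) (hkl : k < l) :
      FRel q N (X i k * X j l)
        (X j l * X i k + (L (h q j i) - R (h q k l)) * X j k * X i l)
  | cross₂ (i j k l : Fin N) (hij : i < j) (hkl : k < l) :
      FRel q N (R (g q k l) * X i k * X j l)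
        (L (g q i j) * X j l * X i k + (R (h q l k) - L (h q i j)) * X i l * X j k)
  | cross₃ (i j k l : Fin N) (hij : i < j) (hkl : k < l) :
      FRel q N (R (g q k l) * X j k * X i l)
        (X i l * X j k + (L (h q i j) - R (h q k l)) * X j l * X i k)

/-- The algebra `F_R(M(N))`. -/
def FR (q : ℂ) (N : ℕ) : Type := RingQuot (FRel q N)

instance (q : ℂ) (N : ℕ) : Ring (FR q N) := inferInstanceAs (Ring (RingQuot (FRel q N)))

instance (q : ℂ) (N : ℕ) : Algebra ℂ (FR q N) :=
  inferInstanceAs (Algebra ℂ (RingQuot (FRel q N)))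

namespace FR

variable {q : ℂ} {N : ℕ}

/-- Image of a generator. -/
def gen (q : ℂ) {N : ℕ} (x : FGen N) : FR q N :=
  RingQuot.mkAlgHom ℂ (FRel q N) (FreeAlgebra.ι ℂ x)

/-- The left moment map `μ_l(f) = f(λ)`. -/
def μl (q : ℂ) {N : ℕ} (f : Mer N) : FR q N := gen q (FGen.l f)

/-- The right moment map `μ_r(f) = f(μ)`. -/
def μr (q : ℂ) {N : ℕ} (f : Mer N) : FR q N := gen q (FGen.r f)

/-- The generators `t_{ij}`. -/
def t (q : ℂ) {N : ℕ} (i j : Fin N) : FR q N := gen q (FGen.t i j)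

/-- The bidegree of a generator: `deg t_{ij} = (e_i, e_j)` and functions have degree `(0, 0)`. -/
def deg {N : ℕ} : FGen N → (Fin N → ℕ) × (Fin N → ℕ)
  | FGen.l _ => 0
  | FGen.r _ => 0
  | FGen.t i j => (Pi.single i 1, Pi.single j 1)

/-- The bihomogeneous component `F_{α β}`: the span of the words of bidegree `(α, β)`. -/
def comp (q : ℂ) {N : ℕ} (α β : Fin N → ℕ) : Submodule ℂ (FR q N) :=
  Submodule.span ℂ
    {x | ∃ w : List (FGen N), (w.map deg).sum = (α, β) ∧ x = (w.map (gen q)).prod}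

/-- The dynamical quantum minor `ξ^I_J`, computed with the column order `ρ`; `I` and `J` are given
by their increasing enumerations. -/
def minor (q : ℂ) {N r : ℕ} (ρ : Equiv.Perm (Fin r)) (I J : Fin r → Fin N) : FR q N :=
  μr q (S q ρ J)⁻¹ * ∑ σ : Equiv.Perm (Fin r),
    μl q (S q σ I) * (List.ofFn fun k : Fin r => t q (I (σ k)) (J (ρ k))).prod

/-- The dynamical quantum determinant `det(T) = ξ^{[1,N]}_{[1,N]}`. -/
def det (q : ℂ) (N : ℕ) (ρ : Equiv.Perm (Fin N)) : FR q N := minor q ρ id id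

theorem mul_mem_comp {α β α' β' : Fin N → ℕ} {x y : FR q N} (hx : x ∈ comp q α β)
    (hy : y ∈ comp q α' β') : x * y ∈ comp q (α + α') (β + β') := by
  have hxy := Submodule.mul_mem_mul hx hy
  rw [comp, comp, Submodule.span_mul_span] at hxy
  refine Submodule.span_mono ?_ hxy
  rintro _ ⟨_, ⟨w, hw, rfl⟩, _, ⟨w', hw', rfl⟩, rfl⟩
  exact ⟨w ++ w', by simp [hw, hw'], by simp⟩

theorem gen_mem_comp (x : FGen N) : gen q x ∈ comp q (deg x).1 (deg x).2 :=
  Submodule.subset_span ⟨[x], by simp, by simp⟩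

theorem μl_mem (f : Mer N) : μl q f ∈ comp q 0 0 := gen_mem_comp (FGen.l f)

theorem μr_mem (f : Mer N) : μr q f ∈ comp q 0 0 := gen_mem_comp (FGen.r f)

theorem prod_mem_comp {r : ℕ} (a b : Fin r → Fin N) :
    (List.ofFn fun k => t q (a k) (b k)).prod ∈
      comp q (∑ k, Pi.single (a k) 1) (∑ k, Pi.single (b k) 1) := by
  refine Submodule.subset_span ⟨List.ofFn fun k => FGen.t (a k) (b k), ?_, ?_⟩
  · rw [List.map_ofFn, List.sum_ofFn]
    ext1 <;> simp [Prod.fst_sum, Prod.snd_sum, deg]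
  · rw [List.map_ofFn]
    rfl

theorem minor_mem {r : ℕ} (ρ : Equiv.Perm (Fin r)) (I J : Fin r → Fin N) :
    minor q ρ I J ∈ comp q (∑ k, Pi.single (I k) 1) (∑ k, Pi.single (J k) 1) := by
  have hsum : (∑ σ : Equiv.Perm (Fin r),
      μl q (S q σ I) * (List.ofFn fun k : Fin r => t q (I (σ k)) (J (ρ k))).prod) ∈
      comp q (∑ k, Pi.single (I k) 1) (∑ k, Pi.single (J k) 1) := by
    refine Submodule.sum_mem _ fun σ _ => ?_
    have h1 := mul_mem_comp (μl_mem (q := q) (S q σ I))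
      (prod_mem_comp (q := q) (fun k => I (σ k)) (fun k => J (ρ k)))
    rw [zero_add, zero_add, Equiv.sum_comp σ (fun k => Pi.single (I k) 1),
      Equiv.sum_comp ρ (fun k => Pi.single (J k) 1)] at h1
    exact h1
  have h2 := mul_mem_comp (μr_mem (q := q) (S q ρ J)⁻¹) hsum
  rwa [zero_add, zero_add] at h2

end FR

/-! ### The algebra `B̃` -/

/-- Generators: a copy of the meromorphic functions and `b̃_{ji}` for `i < j`. -/
inductive BGen (N : ℕ) : Type
  | coeff (f : Mer N)
  | b (j i : Fin N) (hij : i < j)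

namespace BGen

/-- The generator `f(λ)` in the free algebra. -/
abbrev C {N : ℕ} (f : Mer N) : FreeAlgebra ℂ (BGen N) := FreeAlgebra.ι ℂ (BGen.coeff f)

/-- The generator `b̃_{ji}` in the free algebra. -/
abbrev X {N : ℕ} (j i : Fin N) (hij : i < j) : FreeAlgebra ℂ (BGen N) :=
  FreeAlgebra.ι ℂ (BGen.b j i hij)

end BGen

open BGen in
/-- Defining relations of `B̃`: it contains a copy of the meromorphic functions, and `b̃_{ji}` has
weight `ω(i) + ω(j)`. -/
inductive BRel (N : ℕ) : FreeAlgebra ℂ (BGen N) → FreeAlgebra ℂ (BGen N) → Prop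
  | coeff_const (c : ℂ) : BRel N (C (algebraMap ℂ (Mer N) c)) (algebraMap ℂ _ c)
  | coeff_add (f₁ f₂ : Mer N) : BRel N (C (f₁ + f₂)) (C f₁ + C f₂)
  | coeff_mul (f₁ f₂ : Mer N) : BRel N (C (f₁ * f₂)) (C f₁ * C f₂)
  | shift (f : Mer N) (j i : Fin N) (hij : i < j) :
      BRel N (C f * X j i hij) (X j i hij * C (T (ω i + ω j) f))

/-- The algebra `B̃`. -/
def Bt (N : ℕ) : Type := RingQuot (BRel N)

instance (N : ℕ) : Ring (Bt N) := inferInstanceAs (Ring (RingQuot (BRel N)))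

instance (N : ℕ) : Algebra ℂ (Bt N) := inferInstanceAs (Algebra ℂ (RingQuot (BRel N)))

/-- For a scalar map `ι` from meromorphic functions to a ring `E` and an array `X` in `E`, the
tilde Pfaffian `∑_{σ ∈ Π} S̃(σ) X_{σ(2n) σ(2n-1)} ⋯ X_{σ(4) σ(3)} X_{σ(2) σ(1)}`, where `Π` consists
of the `σ` with `σ(2i-1) < σ(2i)` for all `i`. Only the entries `X_{ji}` with `i < j` occur.
(Positions and values are numbered from `0` here.) -/
def Pft (q : ℂ) (n : ℕ) {E : Type} [Ring E] (ι : Mer (2 * n) → E)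
    (X : Fin (2 * n) → Fin (2 * n) → E) : E :=
  ∑ σ : Equiv.Perm (Fin (2 * n)) with
      ∀ k : Fin n, σ ⟨2 * k, by omega⟩ < σ ⟨2 * k + 1, by omega⟩,
    ι (Stilde q σ id) *
      (List.ofFn fun k : Fin n =>
        X (σ ⟨2 * (k.rev : ℕ) + 1, by omega⟩) (σ ⟨2 * (k.rev : ℕ), by omega⟩)).prod

namespace Bt

variable {N : ℕ}

/-- Image of a generator. -/
def gen {N : ℕ} (x : BGen N) : Bt N := RingQuot.mkAlgHom ℂ (BRel N) (FreeAlgebra.ι ℂ x)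

/-- The copy of the meromorphic functions in `B̃`. -/
def coeff {N : ℕ} (f : Mer N) : Bt N := gen (BGen.coeff f)

/-- The generator `b̃_{ji}` for `i < j` (and `0` otherwise). -/
def b {N : ℕ} (j i : Fin N) : Bt N := if hij : i < j then gen (BGen.b j i hij) else 0

/-- The weight of a generator. -/
def deg {N : ℕ} : BGen N → (Fin N → ℕ)
  | BGen.coeff _ => 0
  | BGen.b j i _ => Pi.single i 1 + Pi.single j 1

/-- The weight space `B̃_α`: the span of the words of weight `α`. -/
def comp {N : ℕ} (α : Fin N → ℕ) : Submodule ℂ (Bt N) :=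
  Submodule.span ℂ {x | ∃ w : List (BGen N), (w.map deg).sum = α ∧ x = (w.map gen).prod}

/-- The tilde Pfaffian of the generators of `B̃`. -/
def pf (q : ℂ) (n : ℕ) : Bt (2 * n) := Pft q n coeff b

theorem mul_mem_comp {α α' : Fin N → ℕ} {x y : Bt N} (hx : x ∈ comp α) (hy : y ∈ comp α') :
    x * y ∈ comp (α + α') := by
  have hxy := Submodule.mul_mem_mul hx hy
  rw [comp, comp, Submodule.span_mul_span] at hxy
  refine Submodule.span_mono ?_ hxy
  rintro _ ⟨_, ⟨w, hw, rfl⟩, _, ⟨w', hw', rfl⟩, rfl⟩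
  exact ⟨w ++ w', by simp [hw, hw'], by simp⟩

theorem gen_mem_comp (x : BGen N) : gen x ∈ comp (deg x) :=
  Submodule.subset_span ⟨[x], by simp, by simp⟩

theorem coeff_mem (f : Mer N) : coeff f ∈ comp 0 := gen_mem_comp (BGen.coeff f)

theorem one_mem_comp : (1 : Bt N) ∈ comp 0 := Submodule.subset_span ⟨[], by simp, by simp⟩

theorem b_mem (j i : Fin N) : b j i ∈ comp (Pi.single i 1 + Pi.single j 1) := by
  unfold b
  split_ifs with hij
  · exact gen_mem_comp (BGen.b j i hij)
  · exact Submodule.zero_mem _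

theorem list_prod_mem_comp : ∀ {r : ℕ} (x : Fin r → Bt N) (α : Fin r → Fin N → ℕ),
    (∀ k, x k ∈ comp (α k)) → (List.ofFn x).prod ∈ comp (∑ k, α k)
  | 0, x, α, _ => by simpa using one_mem_comp
  | r + 1, x, α, hx => by
    rw [List.ofFn_succ, List.prod_cons, Fin.sum_univ_succ]
    exact mul_mem_comp (hx 0) (list_prod_mem_comp _ _ fun k => hx k.succ)

theorem sum_pairs {A : Type} [AddCommMonoid A] : ∀ (n : ℕ) (F : Fin (2 * n) → A),
    ∑ k : Fin n, (F ⟨2 * k, by omega⟩ + F ⟨2 * k + 1, by omega⟩) = ∑ m, F m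
  | 0, F => by simp
  | n + 1, F => by
    have ih := sum_pairs n (fun m => F ⟨m, by omega⟩)
    change _ = ∑ m : Fin (2 * n + 1 + 1), F m
    rw [Fin.sum_univ_castSucc, Fin.sum_univ_castSucc (n := 2 * n + 1),
      Fin.sum_univ_castSucc (n := 2 * n), add_assoc]
    exact congrArg₂ (· + ·) ih rfl

theorem pf_mem (q : ℂ) (n : ℕ) : pf q n ∈ comp (∑ k : Fin (2 * n), Pi.single k 1) := by
  refine Submodule.sum_mem _ fun σ _ => ?_
  have h1 := mul_mem_comp (coeff_mem (Stilde q σ id)) (list_prod_mem_comp _ _ fun k : Fin n =>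
    b_mem (σ ⟨2 * (k.rev : ℕ) + 1, by omega⟩) (σ ⟨2 * (k.rev : ℕ), by omega⟩))
  have h2 := Equiv.sum_comp Fin.revPerm (fun k : Fin n =>
      (Pi.single (σ ⟨2 * (k : ℕ), by omega⟩) 1 +
        Pi.single (σ ⟨2 * (k : ℕ) + 1, by omega⟩) 1 : Fin (2 * n) → ℕ))
  simp only [Fin.revPerm_apply] at h2
  rw [zero_add, h2, sum_pairs n (fun m => (Pi.single (σ m) 1 : Fin (2 * n) → ℕ)),
    Equiv.sum_comp σ (fun m => (Pi.single m 1 : Fin (2 * n) → ℕ))] at h1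
  exact h1

end Bt

/-! ### The algebra `B̃ ⊗̃ F_R(M(N))` -/

/-- The subalgebra `⨁_{α, β} B̃_α ⊗ F_{α β}` of the algebra `B̃ ⊗ F_R(M(N))` over `ℂ`. (The span of
the given elements is closed under products, because both gradings are multiplicative.) -/
def matched (q : ℂ) (N : ℕ) : Subalgebra ℂ (Bt N ⊗[ℂ] FR q N) :=
  Algebra.adjoin ℂ {x | ∃ (α β : Fin N → ℕ), ∃ b ∈ Bt.comp α, ∃ a ∈ FR.comp q α β, x = b ⊗ₜ[ℂ] a}

/-- The relations `b ⊗ μ_l(f) a = f b ⊗ a` for `b ∈ B̃_α`, `a ∈ F_{α β}`. -/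
inductive TRel (q : ℂ) (N : ℕ) : matched q N → matched q N → Prop
  | mk (f : Mer N) (α β : Fin N → ℕ) (b : Bt N) (a : FR q N)
      (hb : b ∈ Bt.comp α) (ha : a ∈ FR.comp q α β) (x y : matched q N)
      (hx : (x : Bt N ⊗[ℂ] FR q N) = b ⊗ₜ[ℂ] (FR.μl q f * a))
      (hy : (y : Bt N ⊗[ℂ] FR q N) = (Bt.coeff f * b) ⊗ₜ[ℂ] a) : TRel q N x y

/-- The algebra `B̃ ⊗̃ F_R(M(N))`, with product `(b ⊗ a)(b' ⊗ a') = b b' ⊗ a a'`. -/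
def BF (q : ℂ) (N : ℕ) : Type := RingQuot (TRel q N)

instance (q : ℂ) (N : ℕ) : Ring (BF q N) := inferInstanceAs (Ring (RingQuot (TRel q N)))

instance (q : ℂ) (N : ℕ) : Algebra ℂ (BF q N) := inferInstanceAs (Algebra ℂ (RingQuot (TRel q N)))

namespace BF

/-- The element `b ⊗ a` of `B̃ ⊗̃ F_R(M(N))`, for `b ∈ B̃_α` and `a ∈ F_{α β}`. -/
def tmul {q : ℂ} {N : ℕ} {α β : Fin N → ℕ} (b : Bt N) (a : FR q N) (hb : b ∈ Bt.comp α)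
    (ha : a ∈ FR.comp q α β) : BF q N :=
  RingQuot.mkAlgHom ℂ (TRel q N)
    ⟨b ⊗ₜ[ℂ] a, Algebra.subset_adjoin ⟨α, β, b, hb, a, ha, rfl⟩⟩

/-- The element `1 ⊗ μ_r(f)`; multiplication by it on the left is the action
`f (b ⊗ a) = b ⊗ μ_r(f) a` of the meromorphic functions on `B̃ ⊗̃ F_R(M(N))`. -/
def coeff (q : ℂ) {N : ℕ} (f : Mer N) : BF q N :=
  tmul 1 (FR.μr q f) Bt.one_mem_comp (FR.μr_mem f)

/-- Weight matching for `b̃_{lk} ⊗ ξ^{kl}_{ij}`. -/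
theorem minor_two_mem (q : ℂ) {N : ℕ} (ρ : Equiv.Perm (Fin 2)) (k l i j : Fin N) :
    FR.minor q ρ ![k, l] ![i, j] ∈
      FR.comp q (Pi.single k 1 + Pi.single l 1) (Pi.single i 1 + Pi.single j 1) := by
  simpa [Fin.sum_univ_two] using FR.minor_mem (q := q) ρ ![k, l] ![i, j]

/-- The entries `c_{ji} = ∑_{k < l} b̃_{lk} ⊗ ξ^{kl}_{ij}`. The permutation used to compute the
minor `ξ^{kl}_{ij}` is `ρ k l i j`. -/
def c (q : ℂ) {N : ℕ} (ρ : Fin N → Fin N → Fin N → Fin N → Equiv.Perm (Fin 2)) (j i : Fin N) :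
    BF q N :=
  ∑ p : Fin N × Fin N with p.1 < p.2,
    tmul (Bt.b p.2 p.1) (FR.minor q (ρ p.1 p.2 i j) ![p.1, p.2] ![i, j])
      (Bt.b_mem p.2 p.1) (minor_two_mem q (ρ p.1 p.2 i j) p.1 p.2 i j)

end BF

end DynPf

end

open scoped TensorProduct

noncomputable section

namespace DynPf

/-! ### Generalized alternating sums -/

section Alternating

variable {N : ℕ} {ι : Type} [LinearOrder ι] {K : Type} [Field K]

/-! The classical argument survives: expand the Pfaffian of `C`, collect the coefficient of each
word in the generators of `B̃`, and recognise a Laplace expansion of a determinant.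

For a word given by a sequence of pairs of rows, the coefficient is a sum over `σ ∈ Π` of
`μ_r(S̃(σ))` times a product of two by two minors. By `altSum_laplace` this is an alternating sum
over the columns for the interleaved sequence of rows. It vanishes when a row repeats
(`altSum_eq_zero`), and for a permutation `τ` of the rows it is `μ_l(S̃(τ))` times the sum for the
standard order (`altSum_equiv`). So only the words of `τ ∈ Π` survive, and the relation `b ⊗ μ_l(f)
a = f b ⊗ a` carries `S̃(τ)` over to `B̃`. This leaves the Pfaffian of `B̃` tensored with a
determinant that alternates over columns.

The determinant of the theorem alternates over rows instead. To compare the two, `sum_mul_altSum_eq`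
sums one double alternating expression in both orders: the row determinant and the column
determinant agree after multiplication by `∑_σ ∏_{p < p'} -h(x_{σ p} - x_{σ p'})`. That sum is a
constant, a quantum factorial up to powers of `-q` (`sum_perm_prod_div`), and it is nonzero because
`q` is not a root of unity.

Everything about alternating sums follows formally from the axioms `Exchange`. They hold for `T`,
and also for its transpose with the moment maps exchanged and the order of the indices reversed, so
each lemma serves both rows and columns. -/

/-- The product of `-w (σ p) (σ p')` over the inversions `p < p'` of `σ`. -/
def invWeight (w : ι → ι → K) (σ : Fin N ≃ ι) : K :=
  ∏ p : Fin N × Fin N with p.1 < p.2 ∧ σ p.2 < σ p.1, -w (σ p.1) (σ p.2)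

theorem invWeight_eq_prod_ite (w : ι → ι → K) (σ : Fin N ≃ ι) :
    invWeight w σ = ∏ p : Fin N × Fin N with p.1 < p.2,
      if σ p.2 < σ p.1 then -w (σ p.1) (σ p.2) else 1 := by
  rw [invWeight, ← Finset.filter_filter, Finset.prod_filter]

theorem invWeight_ne_zero {w : ι → ι → K} (hw : ∀ i j, i ≠ j → w i j ≠ 0) (σ : Fin N ≃ ι) :
    invWeight w σ ≠ 0 := by
  refine Finset.prod_ne_zero_iff.2 fun p hp => neg_ne_zero.2 (hw _ _ ?_)
  exact (Finset.mem_filter.1 hp).2.2.ne'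

theorem invWeight_of_strictMono (w : ι → ι → K) {σ : Fin N ≃ ι} (hσ : StrictMono σ) :
    invWeight w σ = 1 := by
  refine Finset.prod_eq_one fun p hp => ?_
  obtain ⟨-, h1, h2⟩ := Finset.mem_filter.1 hp
  exact absurd (hσ h1) h2.asymm

theorem swap_lt_swap_iff {m m' : Fin N} (hm : (m' : ℕ) = m + 1) {p p' : Fin N}
    (hp : ¬(p = m ∧ p' = m')) (hp' : ¬(p = m' ∧ p' = m)) :
    Equiv.swap m m' p < Equiv.swap m m' p' ↔ p < p' := by
  simp only [Equiv.swap_apply_def]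
  split_ifs <;> simp only [Fin.lt_def, Fin.ext_iff] at * <;> omega

/-- The swap permutes the pairs of positions other than `(m, m')` without changing their order, so
that pair is the only new inversion and contributes the only new factor. -/
theorem invWeight_swap (w : ι → ι → K) {m m' : Fin N} (hm : (m' : ℕ) = m + 1) {σ : Fin N ≃ ι}
    (hσ : σ m < σ m') :
    invWeight w ((Equiv.swap m m').trans σ) = -w (σ m') (σ m) * invWeight w σ := by
  have hmm : m < m' := by rw [Fin.lt_def]; omega
  have hmem : (m, m') ∈ Finset.univ.filter fun p : Fin N × Fin N => p.1 < p.2 := by simpa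
  rw [invWeight_eq_prod_ite, invWeight_eq_prod_ite, ← Finset.mul_prod_erase _ _ hmem,
    ← Finset.mul_prod_erase _ _ hmem]
  simp only [Equiv.trans_apply, Equiv.swap_apply_left, Equiv.swap_apply_right, if_pos hσ,
    if_neg hσ.asymm, one_mul]
  congr 1
  refine Finset.prod_equiv ((Equiv.swap m m').prodCongr (Equiv.swap m m')) ?_ ?_
  · rintro ⟨p, p'⟩
    by_cases h1 : p = m ∧ p' = m'
    · simp [h1.1, h1.2, hmm.asymm]
    by_cases h2 : p = m' ∧ p' = m
    · simp [h2.1, h2.2, hmm.asymm]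
    have h3 : ¬(Equiv.swap m m' p = m ∧ Equiv.swap m m' p' = m') := by
      rw [Equiv.swap_apply_eq_iff, Equiv.swap_apply_eq_iff]
      simpa using h2
    simp [swap_lt_swap_iff hm h1 h2, h1, h3]
  · rintro ⟨p, p'⟩ -
    rfl

theorem sum_eq_sum_swap [Fintype ι] {M : Type} [AddCommMonoid M] {m m' : Fin N} (hm : m ≠ m')
    (F : (Fin N ≃ ι) → M) :
    ∑ σ, F σ = ∑ σ : Fin N ≃ ι with σ m < σ m', (F σ + F ((Equiv.swap m m').trans σ)) := by
  rw [Finset.sum_add_distrib, ← Finset.sum_filter_add_sum_filter_not _ fun σ => σ m < σ m']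
  congr 1
  refine Finset.sum_bij' (fun σ _ => (Equiv.swap m m').trans σ)
    (fun σ _ => (Equiv.swap m m').trans σ) ?_ ?_ ?_ ?_ ?_
  · intro σ hσ
    simp only [Finset.mem_filter, Finset.mem_univ, true_and, not_lt] at hσ ⊢
    simpa using lt_of_le_of_ne hσ fun h => hm (σ.injective h).symm
  · intro σ hσ
    simp only [Finset.mem_filter, Finset.mem_univ, true_and, not_lt] at hσ ⊢
    simpa using hσ.le
  · intro σ _; ext; simp
  · intro σ _; ext; simp
  · intro σ _
    congr 1; ext; simp

theorem finRange_split {m m' : Fin N} (hm : (m' : ℕ) = m + 1) :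
    ∃ l₁ l₂ : List (Fin N), List.finRange N = l₁ ++ m :: m' :: l₂ ∧
      ∀ k ∈ l₁ ++ l₂, k ≠ m ∧ k ≠ m' := by
  have h1 : List.finRange N =
      (List.finRange N).take m ++ m :: m' :: (List.finRange N).drop (m' + 1) := by
    conv_lhs => rw [← List.take_append_drop m (List.finRange N)]
    rw [List.drop_eq_getElem_cons (by simp), List.drop_eq_getElem_cons (by simp [← hm])]
    simp [← hm]
  refine ⟨_, _, h1, ?_⟩
  have h2 := List.nodup_finRange N
  rw [h1] at h2
  intro k hk
  have h3 : (m :: m' :: ((List.finRange N).take m ++ (List.finRange N).drop (m' + 1))).Nodup := by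
    refine (List.Perm.nodup_iff ?_).1 h2
    exact (List.perm_middle).trans (List.Perm.cons _ List.perm_middle)
  simp only [List.nodup_cons, List.mem_cons, not_or] at h3
  refine ⟨?_, ?_⟩
  · rintro rfl; exact h3.1.2 hk
  · rintro rfl; exact h3.2.1 hk

/-- A matrix `t` over a ring `A`, with two scalar maps `φ`, `ψ` (acting on the row and on the column
indices), that satisfies the exchange relations of generalized minors. -/
structure Exchange {A : Type} [Ring A] (φ ψ : K →+* A) (w : ι → ι → K) (t : ι → ι → A) :
    Prop where
  ne_zero : ∀ i j, i ≠ j → w i j ≠ 0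
  comm : ∀ f f', Commute (φ f) (ψ f')
  comm_row : ∀ i j k x, k ≠ i → k ≠ j → Commute (φ (w i j)) (t k x)
  comm_col : ∀ i j k x, k ≠ i → k ≠ j → Commute (ψ (w i j)) (t x k)
  shift : ∀ f x, ∃ f', ∀ i, t i x * ψ f = ψ f' * t i x
  col : ∀ i j x, i < j → t i x * t j x = φ (w j i) * (t j x * t i x)
  cross : ∀ i j x y, i < j → x < y →
    t i y * t j x - φ (w j i) * (t j y * t i x) =
      -ψ (w y x) * (t i x * t j y - φ (w j i) * (t j x * t i y))

/-! ### Vanishing, exchange of columns and Laplace expansion of alternating sums -/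

namespace Exchange

variable {A : Type} [Ring A] {φ ψ : K →+* A} {w : ι → ι → K} {t : ι → ι → A}

/-- The scalar `f'` depends on the columns only, not on `σ`, so it can be taken out of a sum over
`σ`. This replaces `comm_col` where columns may repeat. -/
theorem exists_prod_mul_eq (H : Exchange φ ψ w t) (x : Fin N → ι) (l : List (Fin N)) (f : K) :
    ∃ f', ∀ σ : Fin N → ι, (l.map fun k => t (σ k) (x k)).prod * ψ f =
      ψ f' * (l.map fun k => t (σ k) (x k)).prod := by
  induction l with
  | nil => exact ⟨f, fun σ => by simp⟩
  | cons k l ih =>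
    obtain ⟨f₁, h₁⟩ := ih
    obtain ⟨f₂, h₂⟩ := H.shift f₁ (x k)
    refine ⟨f₂, fun σ => ?_⟩
    rw [List.map_cons, List.prod_cons, mul_assoc, h₁, ← mul_assoc, h₂, mul_assoc]

theorem cross_of_ne (H : Exchange φ ψ w t) {x y : ι} (hxy : x ≠ y) :
    ∃ f, ∀ i j, i < j → t i x * t j y - φ (w j i) * (t j x * t i y) =
      ψ f * (t i y * t j x - φ (w j i) * (t j y * t i x)) := by
  rcases lt_or_gt_of_ne hxy with h | h
  · refine ⟨(-w y x)⁻¹, fun i j hij => ?_⟩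
    rw [H.cross i j x y hij h, ← map_neg, ← mul_assoc (ψ _), ← map_mul,
      inv_mul_cancel₀ (neg_ne_zero.2 (H.ne_zero _ _ h.ne')), map_one, one_mul]
  · exact ⟨-w x y, fun i j hij => by rw [H.cross i j y x hij h, map_neg]⟩

/-- The generalized minor on two consecutive positions. -/
def pairMinor (φ : K →+* A) (w : ι → ι → K) (t : ι → ι → A) (i j x y : ι) : A :=
  t i x * t j y - φ (w j i) * (t j x * t i y)

theorem commute_pairMinor (H : Exchange φ ψ w t) {i j a b : ι} (x y : ι) (hai : a ≠ i)
    (haj : a ≠ j) (hbi : b ≠ i) (hbj : b ≠ j) :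
    Commute (φ (w i j)) (pairMinor φ w t a b x y) := by
  have ha := fun x => H.comm_row i j a x hai haj
  have hb := fun x => H.comm_row i j b x hbi hbj
  have hw : Commute (φ (w i j)) (φ (w b a)) := (Commute.all _ _).map φ
  exact ((ha _).mul_right (hb _)).sub_right (hw.mul_right ((hb _).mul_right (ha _)))

variable [Fintype ι]

/-- The generalized alternating sum over the rows, for the sequence `x` of columns. -/
def altSum (φ : K →+* A) (w : ι → ι → K) (t : ι → ι → A) (x : Fin N → ι) : A :=
  ∑ σ : Fin N ≃ ι, φ (invWeight w σ) * (List.ofFn fun k => t (σ k) (x k)).prod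

/-- The terms of `σ` and of its swap differ only at `m` and `m'`, so those positions enter through a
two by two minor. Its weight passes the factors of `l₁` because their rows differ from `σ m` and `σ
m'`. -/
theorem altSum_split {m m' : Fin N} (hm : (m' : ℕ) = m + 1) (H : Exchange φ ψ w t) :
    ∃ l₁ l₂ : List (Fin N), (∀ k ∈ l₁ ++ l₂, k ≠ m ∧ k ≠ m') ∧ ∀ x : Fin N → ι,
      altSum φ w t x = ∑ σ : Fin N ≃ ι with σ m < σ m', φ (invWeight w σ) *
        ((l₁.map fun k => t (σ k) (x k)).prod *
          (t (σ m) (x m) * t (σ m') (x m') -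
            φ (w (σ m') (σ m)) * (t (σ m') (x m) * t (σ m) (x m'))) *
          (l₂.map fun k => t (σ k) (x k)).prod) := by
  obtain ⟨l₁, l₂, hl, hmem⟩ := finRange_split hm
  have hne : m ≠ m' := by rintro rfl; omega
  refine ⟨l₁, l₂, hmem, fun x => ?_⟩
  rw [altSum, sum_eq_sum_swap hne]
  refine Finset.sum_congr rfl fun σ hσ => ?_
  have hlt : σ m < σ m' := (Finset.mem_filter.1 hσ).2
  have hs : ∀ k ∈ l₁ ++ l₂, Equiv.swap m m' k = k := fun k hk =>
    Equiv.swap_apply_of_ne_of_ne (hmem k hk).1 (hmem k hk).2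
  have e1 : (l₁.map fun k => t (σ (Equiv.swap m m' k)) (x k)) = l₁.map fun k => t (σ k) (x k) :=
    List.map_congr_left fun k hk => by rw [hs k (List.mem_append_left _ hk)]
  have e2 : (l₂.map fun k => t (σ (Equiv.swap m m' k)) (x k)) = l₂.map fun k => t (σ k) (x k) :=
    List.map_congr_left fun k hk => by rw [hs k (List.mem_append_right _ hk)]
  have hc : Commute (φ (w (σ m') (σ m))) (l₁.map fun k => t (σ k) (x k)).prod := by
    refine Commute.list_prod_right _ _ fun y hy => ?_
    obtain ⟨k, hk, rfl⟩ := List.mem_map.1 hy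
    have := hmem k (List.mem_append_left _ hk)
    exact H.comm_row _ _ _ _ (fun h => this.2 (σ.injective h)) fun h => this.1 (σ.injective h)
  rw [invWeight_swap w hm hlt, List.ofFn_eq_map, List.ofFn_eq_map, hl]
  simp only [List.map_append, List.map_cons, List.prod_append, List.prod_cons, Equiv.trans_apply,
    Equiv.swap_apply_left, Equiv.swap_apply_right, e1, e2, map_mul, map_neg]
  have ha : φ (w (σ m') (σ m)) * φ (invWeight w σ) =
      φ (invWeight w σ) * φ (w (σ m') (σ m)) := by rw [← map_mul, ← map_mul, mul_comm]
  rw [mul_sub, sub_mul, mul_sub, ← mul_assoc (List.prod _) (φ (w (σ m') (σ m))), ← hc.eq,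
    neg_mul, ha]
  noncomm_ring

theorem altSum_eq_zero_of_adjacent {m m' : Fin N} (hm : (m' : ℕ) = m + 1) (H : Exchange φ ψ w t)
    {x : Fin N → ι} (hx : x m = x m') : altSum φ w t x = 0 := by
  obtain ⟨l₁, l₂, -, h⟩ := altSum_split hm H
  rw [h]
  refine Finset.sum_eq_zero fun σ hσ => ?_
  rw [← hx, H.col _ _ _ (Finset.mem_filter.1 hσ).2, sub_self]
  simp

/-- Only the existence of a scalar is claimed: columns may repeat elsewhere, and then the scalar
changes on its way to the left. -/
theorem exists_altSum_swap {m m' : Fin N} (hm : (m' : ℕ) = m + 1) (H : Exchange φ ψ w t)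
    {x : Fin N → ι} (hx : x m ≠ x m') :
    ∃ f, altSum φ w t x = ψ f * altSum φ w t (x ∘ Equiv.swap m m') := by
  obtain ⟨l₁, l₂, hl, h⟩ := altSum_split hm H
  obtain ⟨f, hf⟩ := H.cross_of_ne hx
  obtain ⟨f', hf'⟩ := H.exists_prod_mul_eq x l₁ f
  refine ⟨f', ?_⟩
  have hs : ∀ k ∈ l₁ ++ l₂, Equiv.swap m m' k = k := fun k hk =>
    Equiv.swap_apply_of_ne_of_ne (hl k hk).1 (hl k hk).2
  rw [h, h, Finset.mul_sum]
  refine Finset.sum_congr rfl fun σ hσ => ?_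
  have e1 : (l₁.map fun k => t (σ k) (x (Equiv.swap m m' k))) = l₁.map fun k => t (σ k) (x k) :=
    List.map_congr_left fun k hk => by rw [hs k (List.mem_append_left _ hk)]
  have e2 : (l₂.map fun k => t (σ k) (x (Equiv.swap m m' k))) = l₂.map fun k => t (σ k) (x k) :=
    List.map_congr_left fun k hk => by rw [hs k (List.mem_append_right _ hk)]
  simp only [Function.comp_apply, Equiv.swap_apply_left, Equiv.swap_apply_right, e1, e2]
  rw [hf _ _ (Finset.mem_filter.1 hσ).2, ← mul_assoc (List.prod _) (ψ f), hf' σ,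
    ← mul_assoc (ψ f'), ← (H.comm _ f').eq]
  simp only [mul_assoc]

theorem altSum_eq_zero (H : Exchange φ ψ w t) {x : Fin N → ι} (hx : ¬Function.Injective x) :
    altSum φ w t x = 0 := by
  -- Induction on the distance between two equal columns: an adjacent swap brings the right one
  -- closer, at the cost of a left factor whose value is irrelevant.
  have key : ∀ (d : ℕ) (x : Fin N → ι) (p p' : Fin N), (p' : ℕ) = p + d + 1 → x p = x p' →
      altSum φ w t x = 0 := by
    intro d
    induction d with
    | zero => exact fun x p p' hp h => altSum_eq_zero_of_adjacent hp H h
    | succ d ih =>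
      intro x p p' hp h
      let m : Fin N := ⟨p + d + 1, by omega⟩
      have hm : (p' : ℕ) = m + 1 := by simp only [m]; omega
      by_cases hx : x m = x p'
      · exact altSum_eq_zero_of_adjacent hm H hx
      obtain ⟨f, hf⟩ := exists_altSum_swap hm H hx
      rw [hf, ih (x ∘ Equiv.swap m p') p m rfl, mul_zero]
      have h1 : p ≠ m := by rw [Ne, Fin.ext_iff]; simp only [m]; omega
      have h2 : p ≠ p' := by rw [Ne, Fin.ext_iff]; omega
      simp [Equiv.swap_apply_of_ne_of_ne h1 h2, h]
  obtain ⟨a, b, hab, hne⟩ : ∃ a b, x a = x b ∧ a ≠ b := by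
    simpa [Function.Injective] using hx
  rcases lt_or_gt_of_ne hne with hlt | hlt
  · exact key (b - a - 1) x a b (by rw [Fin.lt_def] at hlt; omega) hab
  · exact key (a - b - 1) x b a (by rw [Fin.lt_def] at hlt; omega) hab.symm

/-- Since `τ` is injective, the other columns avoid `τ m` and `τ m'`, so by `comm_col` the scalar
reaches the left unchanged. -/
theorem altSum_swap {m m' : Fin N} (hm : (m' : ℕ) = m + 1) (H : Exchange φ ψ w t)
    {τ : Fin N ≃ ι} (hτ : τ m < τ m') :
    altSum φ w t ((Equiv.swap m m').trans τ) = ψ (-w (τ m') (τ m)) * altSum φ w t τ := by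
  obtain ⟨l₁, l₂, hl, h⟩ := altSum_split hm H
  have hs : ∀ k ∈ l₁ ++ l₂, Equiv.swap m m' k = k := fun k hk =>
    Equiv.swap_apply_of_ne_of_ne (hl k hk).1 (hl k hk).2
  rw [h, h, Finset.mul_sum]
  refine Finset.sum_congr rfl fun σ hσ => ?_
  have e1 : (l₁.map fun k => t (σ k) (τ (Equiv.swap m m' k))) = l₁.map fun k => t (σ k) (τ k) :=
    List.map_congr_left fun k hk => by rw [hs k (List.mem_append_left _ hk)]
  have e2 : (l₂.map fun k => t (σ k) (τ (Equiv.swap m m' k))) = l₂.map fun k => t (σ k) (τ k) :=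
    List.map_congr_left fun k hk => by rw [hs k (List.mem_append_right _ hk)]
  have hc : Commute (ψ (-w (τ m') (τ m))) (l₁.map fun k => t (σ k) (τ k)).prod := by
    refine Commute.list_prod_right _ _ fun y hy => ?_
    obtain ⟨k, hk, rfl⟩ := List.mem_map.1 hy
    have := hl k (List.mem_append_left _ hk)
    rw [map_neg]
    exact (H.comm_col _ _ _ _ (fun h => this.2 (τ.injective h))
      fun h => this.1 (τ.injective h)).neg_left
  simp only [Equiv.trans_apply, Equiv.swap_apply_left, Equiv.swap_apply_right, e1, e2]
  rw [H.cross _ _ _ _ (Finset.mem_filter.1 hσ).2 hτ, ← map_neg,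
    ← mul_assoc (List.prod _) (ψ _), ← hc.eq, ← mul_assoc (ψ _) (φ _), ← (H.comm _ _).eq]
  simp only [mul_assoc]

theorem altSum_equiv (H : Exchange φ ψ w t) {τ₀ : Fin N ≃ ι} (hτ₀ : StrictMono τ₀)
    (τ : Fin N ≃ ι) : altSum φ w t τ = ψ (invWeight w τ) * altSum φ w t τ₀ := by
  have step : ∀ (τ : Fin N ≃ ι) (m m' : Fin N), (m' : ℕ) = m + 1 →
      altSum φ w t τ = ψ (invWeight w τ) * altSum φ w t τ₀ →
      altSum φ w t ((Equiv.swap m m').trans τ) =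
        ψ (invWeight w ((Equiv.swap m m').trans τ)) * altSum φ w t τ₀ := by
    intro τ m m' hm hτ
    have hne : m ≠ m' := by rintro rfl; omega
    rcases lt_or_gt_of_ne fun h => hne (τ.injective h) with hlt | hlt
    · rw [altSum_swap hm H hlt, invWeight_swap w hm hlt, hτ, map_mul, mul_assoc]
    -- At a descent, `τ` is the swap of an ascending `τ'`; the formula for that swap is inverted,
    -- its factor being nonzero.
    · set τ' := (Equiv.swap m m').trans τ with hτ'
      have hlt' : τ' m < τ' m' := by simpa [hτ'] using hlt
      have hτ'' : τ = (Equiv.swap m m').trans τ' := by ext; simp [hτ']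
      rw [hτ'', altSum_swap hm H hlt', invWeight_swap w hm hlt', map_mul, mul_assoc] at hτ
      have h0 : -w (τ' m') (τ' m) ≠ 0 := neg_ne_zero.2 (H.ne_zero _ _ hlt'.ne')
      have := congrArg (ψ (-w (τ' m') (τ' m))⁻¹ * ·) hτ
      simpa only [← mul_assoc, ← map_mul, inv_mul_cancel_left₀ h0, inv_mul_cancel₀ h0, map_one,
        one_mul] using this
  obtain ⟨π, rfl⟩ : ∃ π : Equiv.Perm (Fin N), τ = π.trans τ₀ := ⟨τ.trans τ₀.symm, by ext; simp⟩
  rcases N with _ | N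
  · have : π = Equiv.refl _ := Subsingleton.elim _ _
    subst this
    rw [invWeight_of_strictMono w (σ := (Equiv.refl _).trans τ₀) hτ₀, map_one, one_mul]
    rfl
  have hπ : π ∈ Submonoid.closure (Set.range fun i : Fin N => Equiv.swap i.castSucc i.succ) := by
    rw [Equiv.Perm.mclosure_swap_castSucc_succ]; trivial
  induction hπ using Submonoid.closure_induction_right with
  | one =>
    change altSum φ w t τ₀ = ψ (invWeight w τ₀) * _
    rw [invWeight_of_strictMono w hτ₀, map_one, one_mul]
  | mul_right x hx y hy ih =>
    obtain ⟨i, rfl⟩ := hy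
    exact step (Equiv.trans x τ₀) _ _ (by simp) ih

/-- Laplace expansion of a generalized alternating sum along consecutive pairs of columns. -/
theorem altSum_laplace {n : ℕ} (H : Exchange φ ψ w t) (x : Fin (2 * n) → ι) :
    ∑ σ : Fin (2 * n) ≃ ι with ∀ k : Fin n, σ ⟨2 * k, by omega⟩ < σ ⟨2 * k + 1, by omega⟩,
      φ (invWeight w σ) * (List.ofFn fun k : Fin n =>
        pairMinor φ w t (σ ⟨2 * k, by omega⟩) (σ ⟨2 * k + 1, by omega⟩)
          (x ⟨2 * k, by omega⟩) (x ⟨2 * k + 1, by omega⟩)).prod = altSum φ w t x := by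
  let e : Fin n → Fin (2 * n) := fun k => ⟨2 * k, by omega⟩
  let o : Fin n → Fin (2 * n) := fun k => ⟨2 * k + 1, by omega⟩
  let Q : (Fin (2 * n) ≃ ι) → Fin n → A := fun σ k =>
    pairMinor φ w t (σ (e k)) (σ (o k)) (x (e k)) (x (o k))
  let R : (Fin (2 * n) ≃ ι) → Fin n → A := fun σ k => t (σ (e k)) (x (e k)) * t (σ (o k)) (x (o k))
  -- Minors in the first `j` slots, plain products in the rest. Raising `j` merges the terms of `σ`
  -- and of its swap at positions `2j` and `2j + 1`. Only row weights are moved, so `x` is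
  -- arbitrary.
  let B : ℕ → (Fin (2 * n) ≃ ι) → Fin n → A := fun j σ k => if (k : ℕ) < j then Q σ k else R σ k
  have key : ∀ j ≤ n, ∑ σ : Fin (2 * n) ≃ ι with ∀ k : Fin n, (k : ℕ) < j → σ (e k) < σ (o k),
      φ (invWeight w σ) * ((List.finRange n).map (B j σ)).prod = altSum φ w t x := by
    intro j
    induction j with
    | zero =>
      intro _
      simp only [Nat.not_lt_zero, false_imp_iff, implies_true, Finset.filter_true, B, if_false]
      refine Finset.sum_congr rfl fun σ _ => ?_
      rw [List.ofFn_mul', List.prod_flatten, List.map_ofFn, List.ofFn_eq_map]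
      congr 3
      ext k
      simp [R, e, o]
    | succ j ih =>
      intro hj
      rw [← ih (by omega)]
      let m : Fin n := ⟨j, hj⟩
      have hmm : ((o m : Fin (2 * n)) : ℕ) = (e m : ℕ) + 1 := rfl
      have hne : e m ≠ o m := by simp [Fin.ext_iff, e, o]
      have hfix : ∀ k, k ≠ m → Equiv.swap (e m) (o m) (e k) = e k ∧
          Equiv.swap (e m) (o m) (o k) = o k := by
        intro k hk
        rw [Ne, Fin.ext_iff] at hk
        constructor <;> refine Equiv.swap_apply_of_ne_of_ne ?_ ?_ <;>
          simp only [e, o, Ne, Fin.ext_iff] <;> omega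
      symm
      rw [Finset.sum_filter, sum_eq_sum_swap hne, Finset.sum_filter, Finset.sum_filter]
      refine Finset.sum_congr rfl fun σ _ => ?_
      by_cases hσ : σ (e m) < σ (o m)
      swap
      · rw [if_neg hσ, if_neg fun h => hσ (h m (Nat.lt_succ_self j))]
      have hiff : (∀ k : Fin n, (k : ℕ) < j + 1 → σ (e k) < σ (o k)) ↔
          ∀ k : Fin n, (k : ℕ) < j → σ (e k) < σ (o k) := by
        refine ⟨fun h k hk => h k (by omega), fun h k hk => ?_⟩
        rcases Nat.lt_succ_iff_lt_or_eq.1 hk with h1 | h1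
        · exact h k h1
        · rwa [show k = m from Fin.ext h1]
      have hiff' : (∀ k : Fin n, (k : ℕ) < j →
          ((Equiv.swap (e m) (o m)).trans σ) (e k) < ((Equiv.swap (e m) (o m)).trans σ) (o k)) ↔
          ∀ k : Fin n, (k : ℕ) < j → σ (e k) < σ (o k) := by
        refine forall₂_congr fun k hk => ?_
        have := hfix k (by rintro rfl; exact lt_irrefl _ hk)
        rw [Equiv.trans_apply, Equiv.trans_apply, this.1, this.2]
      simp only [if_pos hσ, hiff, hiff']
      by_cases hc : ∀ k : Fin n, (k : ℕ) < j → σ (e k) < σ (o k)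
      swap
      · simp only [if_neg hc, add_zero]
      simp only [if_pos hc]
      obtain ⟨l₁, l₂, hl⟩ := List.append_of_mem (List.mem_finRange m)
      have hnd := List.nodup_finRange n
      rw [hl] at hnd
      have hnot : ∀ k ∈ l₁ ++ l₂, k ≠ m := by
        have := (List.perm_middle.nodup_iff.1 hnd)
        rw [List.nodup_cons] at this
        rintro k hk rfl
        exact this.1 hk
      have hB : ∀ k ∈ l₁ ++ l₂, B (j + 1) σ k = B j σ k := by
        intro k hk
        have h1 : (k : ℕ) ≠ j := fun h => hnot k hk (Fin.ext h)
        simp only [B]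
        congr 1
        rw [eq_iff_iff]; omega
      have hB' : ∀ k ∈ l₁ ++ l₂, B j ((Equiv.swap (e m) (o m)).trans σ) k = B j σ k := by
        intro k hk
        have := hfix k (hnot k hk)
        simp only [B, Q, R, Equiv.trans_apply, this.1, this.2]
      have hcomm : Commute (φ (w (σ (o m)) (σ (e m)))) (l₁.map (B j σ)).prod := by
        refine Commute.list_prod_right _ _ fun y hy => ?_
        obtain ⟨k, hk, rfl⟩ := List.mem_map.1 hy
        have hkm : (k : ℕ) ≠ j := fun h => hnot k (List.mem_append_left _ hk) (Fin.ext h)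
        have h1 : σ (e k) ≠ σ (o m) := by
          rw [Ne, σ.injective.eq_iff]; simp only [e, o, m, Fin.ext_iff]; omega
        have h2 : σ (e k) ≠ σ (e m) := by
          rw [Ne, σ.injective.eq_iff]; simp only [e, m, Fin.ext_iff]; omega
        have h3 : σ (o k) ≠ σ (o m) := by
          rw [Ne, σ.injective.eq_iff]; simp only [o, m, Fin.ext_iff]; omega
        have h4 : σ (o k) ≠ σ (e m) := by
          rw [Ne, σ.injective.eq_iff]; simp only [e, o, m, Fin.ext_iff]; omega
        simp only [B]
        split_ifs
        · exact H.commute_pairMinor _ _ h1 h2 h3 h4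
        · exact (H.comm_row _ _ _ _ h1 h2).mul_right (H.comm_row _ _ _ _ h3 h4)
      have e1 : l₁.map (B (j + 1) σ) = l₁.map (B j σ) :=
        List.map_congr_left fun k hk => hB k (List.mem_append_left _ hk)
      have e2 : l₂.map (B (j + 1) σ) = l₂.map (B j σ) :=
        List.map_congr_left fun k hk => hB k (List.mem_append_right _ hk)
      have e3 : l₁.map (B j ((Equiv.swap (e m) (o m)).trans σ)) = l₁.map (B j σ) :=
        List.map_congr_left fun k hk => hB' k (List.mem_append_left _ hk)
      have e4 : l₂.map (B j ((Equiv.swap (e m) (o m)).trans σ)) = l₂.map (B j σ) :=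
        List.map_congr_left fun k hk => hB' k (List.mem_append_right _ hk)
      have b1 : B (j + 1) σ m = Q σ m := if_pos (Nat.lt_succ_self j)
      have b2 : ∀ τ, B j τ m = R τ m := fun τ => if_neg (lt_irrefl j)
      rw [hl]
      simp only [List.map_append, List.map_cons, List.prod_append, List.prod_cons, e1, e2, e3, e4,
        b1, b2, Q, R, pairMinor, Equiv.trans_apply, Equiv.swap_apply_left,
        Equiv.swap_apply_right]
      rw [invWeight_swap w hmm hσ]
      have ha : φ (w (σ (o m)) (σ (e m))) * φ (invWeight w σ) =
          φ (invWeight w σ) * φ (w (σ (o m)) (σ (e m))) := by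
        rw [← map_mul, ← map_mul, mul_comm]
      rw [sub_mul, mul_sub, mul_assoc (φ (w _ _)), ← mul_assoc (List.prod _) (φ (w _ _)),
        ← hcomm.eq, map_mul, map_neg, neg_mul, ha]
      noncomm_ring
  rw [← key n le_rfl]
  refine Finset.sum_congr ?_ fun σ _ => ?_
  · ext σ
    simp [e, o]
  · rw [List.ofFn_eq_map]
    simp only [B, Fin.is_lt, if_true, Q, e, o]

end Exchange

/-- The matrix `t` with rows and columns exchanged and the indices in the opposite order. -/
def transposeDual {A : Type} (t : ι → ι → A) (i j : ιᵒᵈ) : A :=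
  t (OrderDual.ofDual j) (OrderDual.ofDual i)

/-- The weights `w` on indices in the opposite order. -/
def weightDual (w : ι → ι → K) (i j : ιᵒᵈ) : K := w (OrderDual.ofDual i) (OrderDual.ofDual j)

/-- Each pair of positions is an inversion for exactly one of the two orders, so together the two
weights run over all pairs. -/
theorem invWeight_mul_invWeight_toDual (w : ι → ι → K) (σ : Fin N ≃ ι) :
    invWeight w σ * invWeight (weightDual w) (σ.trans OrderDual.toDual) =
      ∏ p : Fin N × Fin N with p.1 < p.2, -w (σ p.1) (σ p.2) := by
  rw [invWeight_eq_prod_ite, invWeight_eq_prod_ite, ← Finset.prod_mul_distrib]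
  refine Finset.prod_congr rfl fun p hp => ?_
  have hne : σ p.1 ≠ σ p.2 := fun h => (Finset.mem_filter.1 hp).2.ne (σ.injective h)
  simp only [Equiv.trans_apply, OrderDual.toDual_lt_toDual, weightDual, OrderDual.ofDual_toDual]
  rcases lt_or_gt_of_ne hne with hlt | hlt
  · rw [if_neg hlt.asymm, if_pos hlt, one_mul]
  · rw [if_pos hlt, if_neg hlt.asymm, mul_one]

/-- Comparison of the alternating sums over the rows and over the columns. -/
theorem Exchange.sum_mul_altSum_eq [Fintype ι] {A : Type} [Ring A] {φ ψ : K →+* A}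
    {w : ι → ι → K} {t : ι → ι → A} (H : Exchange φ ψ w t)
    (H' : Exchange ψ φ (weightDual w) (transposeDual t)) {τ₀ : Fin N ≃ ι} (hτ₀ : StrictMono τ₀)
    {τ₁ : Fin N ≃ ιᵒᵈ} (hτ₁ : StrictMono τ₁) :
    ψ (∑ σ : Fin N ≃ ι, ∏ p : Fin N × Fin N with p.1 < p.2, -w (σ p.1) (σ p.2)) *
        altSum φ w t τ₀ =
      φ (∑ σ : Fin N ≃ ι, ∏ p : Fin N × Fin N with p.1 < p.2, -w (σ p.1) (σ p.2)) *
        altSum ψ (weightDual w) (transposeDual t) τ₁ := by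
  let e : (Fin N ≃ ι) ≃ (Fin N ≃ ιᵒᵈ) := (Equiv.refl _).equivCongr OrderDual.toDual
  -- The doubly alternating term. Summation over `σ` produces the row sum and summation over `τ` the
  -- column sum; in each case the two signs of the other permutation combine to a product over all
  -- pairs.
  let W : (Fin N ≃ ι) → (Fin N ≃ ι) → A := fun σ τ =>
    φ (invWeight w σ) * (ψ (invWeight (weightDual w) (e τ)) *
      (List.ofFn fun k => t (σ k) (τ k)).prod)
  have h1 : ∀ τ, ∑ σ, W σ τ = ψ (∏ p : Fin N × Fin N with p.1 < p.2, -w (τ p.1) (τ p.2)) *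
      altSum φ w t τ₀ := by
    intro τ
    rw [← invWeight_mul_invWeight_toDual, mul_comm, map_mul, mul_assoc,
      ← H.altSum_equiv hτ₀ τ, altSum, Finset.mul_sum]
    refine Finset.sum_congr rfl fun σ _ => ?_
    simp only [W]
    rw [← mul_assoc, (H.comm _ _).eq, mul_assoc]
    rfl
  have h2 : ∀ σ, ∑ τ, W σ τ = φ (∏ p : Fin N × Fin N with p.1 < p.2, -w (σ p.1) (σ p.2)) *
      altSum ψ (weightDual w) (transposeDual t) τ₁ := by
    intro σ
    rw [← invWeight_mul_invWeight_toDual, map_mul, mul_assoc,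
      ← H'.altSum_equiv hτ₁ (σ.trans OrderDual.toDual), altSum, ← Equiv.sum_comp e,
      Finset.mul_sum]
    rfl
  have h3 := Finset.sum_comm (s := Finset.univ) (t := Finset.univ) (f := W)
  simp only [h1, h2, ← Finset.sum_mul, ← map_sum] at h3
  exact h3.symm

end Alternating

/-! ### A symmetrization identity -/

section Symmetrization

variable {K : Type} [Field K]

open Polynomial in
-- Lagrange interpolation of `∏ (X - s x_j) - ∏ (X - x_j)` at the nodes `x_k`, evaluated at `0`.
-- Both products are monic, so the degree is below the number of nodes.
theorem sum_prod_erase_div {n : ℕ} (s : K) (x : Fin (n + 1) → K) (hx : Function.Injective x)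
    (hx0 : ∀ i, x i ≠ 0) (hs : s ≠ 1) :
    ∑ k, ∏ j ∈ Finset.univ.erase k, (x k - s * x j) / (x k - x j) =
      (1 - s ^ (n + 1)) / (1 - s) := by
  let p : K[X] := ∏ j, (X - C (s * x j)) - ∏ j, (X - C (x j))
  have hdeg : p.degree < (Finset.univ : Finset (Fin (n + 1))).card := by
    have h1 : (∏ j, (X - C (s * x j))).degree = ((n + 1 : ℕ) : WithBot ℕ) := by
      rw [degree_prod]
      simp only [degree_X_sub_C, Finset.sum_const, Finset.card_univ, Fintype.card_fin, nsmul_one]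
    have h2 : (∏ j, (X - C (x j))).degree = ((n + 1 : ℕ) : WithBot ℕ) := by
      rw [degree_prod]; simp
    have := degree_sub_lt_left (h1.trans h2.symm) (by
      intro h; rw [h, degree_zero] at h1; exact WithBot.bot_ne_natCast _ h1) (by
      rw [(monic_prod_of_monic _ _ fun j _ => monic_X_sub_C _).leadingCoeff,
        (monic_prod_of_monic _ _ fun j _ => monic_X_sub_C _).leadingCoeff])
    rw [h1] at this
    simpa [p] using this
  have hint := Lagrange.eq_interpolate (s := Finset.univ) (v := x) hx.injOn hdeg
  have h0 := congrArg (eval 0) hint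
  have hterm : ∀ k, eval 0 (C (eval (x k) p) * Lagrange.basis Finset.univ x k) =
      -((1 - s) * ∏ j, -x j) * ∏ j ∈ Finset.univ.erase k, (x k - s * x j) / (x k - x j) := by
    intro k
    have hk := Finset.mem_univ k
    simp only [p, eval_mul, eval_C, Lagrange.basis, eval_prod, Lagrange.basisDivisor, eval_sub,
      eval_X]
    rw [← Finset.mul_prod_erase _ (fun j => x k - s * x j) hk,
      ← Finset.mul_prod_erase _ (fun j => x k - x j) hk,
      ← Finset.mul_prod_erase _ (fun j => -x j) hk,
      sub_self, zero_mul, sub_zero, mul_assoc, ← Finset.prod_mul_distrib]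
    have : -((1 - s) * (-x k * ∏ j ∈ Finset.univ.erase k, -x j)) =
        (x k - s * x k) * ∏ j ∈ Finset.univ.erase k, -x j := by ring
    rw [this, mul_assoc, ← Finset.prod_mul_distrib]
    congr 1
    refine Finset.prod_congr rfl fun j _ => ?_
    rw [div_eq_mul_inv]; ring
  rw [Lagrange.interpolate_apply, eval_finsetSum, Finset.sum_congr rfl fun k _ => hterm k,
    ← Finset.mul_sum] at h0
  have hp : eval 0 p = (s ^ (n + 1) - 1) * ∏ j, -x j := by
    have : ∏ j, -(s * x j) = s ^ (n + 1) * ∏ j, -x j := by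
      simp only [← mul_neg, Finset.prod_mul_distrib, Finset.prod_const, Finset.card_univ,
        Fintype.card_fin]
    simp only [p, eval_sub, eval_prod, eval_X, eval_C, zero_sub, this]
    ring
  have hne : ∏ j, -x j ≠ 0 := Finset.prod_ne_zero_iff.2 fun j _ => neg_ne_zero.2 (hx0 j)
  have hs' : 1 - s ≠ 0 := sub_ne_zero.2 hs.symm
  rw [hp] at h0
  rw [eq_div_iff hs']
  refine mul_right_cancel₀ hne ?_
  linear_combination h0

/-- The sum over all permutations of `∏_{p < p'} (x_{σ p} - s x_{σ p'}) / (x_{σ p} - x_{σ p'})` is a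
quantum factorial. -/
theorem sum_perm_prod_div {n : ℕ} (s c : K) (x : Fin n → K) (hx : Function.Injective x)
    (hx0 : ∀ i, x i ≠ 0) (hs : s ≠ 1) :
    ∑ σ : Equiv.Perm (Fin n), ∏ p : Fin n × Fin n with p.1 < p.2,
      c * ((x (σ p.1) - s * x (σ p.2)) / (x (σ p.1) - x (σ p.2))) =
      ∏ k ∈ Finset.range n, c ^ k * ((1 - s ^ (k + 1)) / (1 - s)) := by
  have hpairs : ∀ {m : ℕ} (f : Fin m → Fin m → K),
      ∏ p : Fin m × Fin m with p.1 < p.2, f p.1 p.2 =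
        ∏ a, ∏ b, if a < b then f a b else 1 := by
    intro m f
    rw [Finset.prod_filter, ← Finset.univ_product_univ, Finset.prod_product]
  induction n with
  | zero => simp
  | succ n ih =>
    have hf : ∀ (y : Fin (n + 1) → K) (f : K → K → K),
        ∏ p : Fin (n + 1) × Fin (n + 1) with p.1 < p.2, f (y p.1) (y p.2) =
        (∏ b : Fin n, f (y 0) (y b.succ)) *
          ∏ p : Fin n × Fin n with p.1 < p.2, f (y p.1.succ) (y p.2.succ) := by
      intro y f
      rw [hpairs fun a b => f (y a) (y b), hpairs fun a b => f (y a.succ) (y b.succ),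
        Fin.prod_univ_succ]
      congr 1
      · simp [Fin.prod_univ_succ]
      · refine Finset.prod_congr rfl fun a _ => ?_
        simp [Fin.prod_univ_succ]
    -- Split by the first value `k = σ 0`. The pairs containing position `0` give `c ^ n` times the
    -- product in `sum_prod_erase_div`; the sum over the rest is, by induction, independent of `k`.
    rw [← Equiv.sum_comp Equiv.Perm.decomposeFin.symm, Fintype.sum_prod_type,
      Finset.prod_range_succ, mul_comm, ← sum_prod_erase_div s x hx hx0 hs, Finset.mul_sum,
      Finset.sum_mul]
    refine Finset.sum_congr rfl fun k _ => ?_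
    let y : Fin n → K := fun i => x (Equiv.swap 0 k i.succ)
    have hy : Function.Injective y := fun a b h =>
      Fin.succ_injective _ ((Equiv.swap 0 k).injective (hx h))
    rw [← ih y hy fun i => hx0 _, Finset.mul_sum]
    refine Finset.sum_congr rfl fun e _ => ?_
    have := hf (fun i => x (Equiv.Perm.decomposeFin.symm (k, e) i))
      fun a b => c * ((a - s * b) / (a - b))
    rw [this]
    simp only [Equiv.Perm.decomposeFin_symm_apply_zero, Equiv.Perm.decomposeFin_symm_apply_succ]
    congr 1
    rw [Equiv.prod_comp e fun i => c * ((x k - s * x (Equiv.swap 0 k i.succ)) /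
      (x k - x (Equiv.swap 0 k i.succ))), Finset.prod_mul_distrib, Finset.prod_const,
      Finset.card_univ, Fintype.card_fin]
    congr 1
    refine Finset.prod_bij (fun i _ => Equiv.swap 0 k i.succ) ?_ ?_ ?_ ?_
    · intro i _
      simp only [Finset.mem_erase, Finset.mem_univ, and_true, Ne, Equiv.swap_apply_eq_iff,
        Equiv.swap_apply_right]
      exact Fin.succ_ne_zero i
    · intro a _ b _ h
      exact Fin.succ_injective _ ((Equiv.swap 0 k).injective h)
    · intro j hj
      have hj' : Equiv.swap 0 k j ≠ 0 := by
        rw [Ne, Equiv.swap_apply_eq_iff, Equiv.swap_apply_left]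
        exact (Finset.mem_erase.1 hj).1
      obtain ⟨i, hi⟩ := Fin.exists_succ_eq.2 hj'
      exact ⟨i, Finset.mem_univ _, by rw [hi, Equiv.swap_apply_self]⟩
    · intro i _; rfl

end Symmetrization

/-! ### The function `h` -/

section Coefficients

variable {q : ℂ} {N : ℕ}

/-- The entire function `x ↦ q ^ (-2 x_i)`. -/
def qpowCoord (q : ℂ) {N : ℕ} (i : Fin N) : Entire N :=
  ⟨fun x => Complex.exp (-2 * x i * Complex.log q), by
    change Differentiable ℂ _
    fun_prop⟩

theorem qpow_mul_qpowCoord (q : ℂ) (i j : Fin N) :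
    qpow q i j * qpowCoord q j = qpowCoord q i := by
  ext x
  change Complex.exp _ * Complex.exp _ = Complex.exp _
  rw [← Complex.exp_add]
  congr 1; ring

theorem exp_neg_two_mul_log (hq : q ≠ 0) : Complex.exp (-2 * Complex.log q) = q⁻¹ ^ 2 := by
  rw [show -2 * Complex.log q = -Complex.log q + -Complex.log q by ring, Complex.exp_add,
    Complex.exp_neg, Complex.exp_log hq, sq]

/-- The image of `x ↦ q ^ (-2 x_i)` in the field of meromorphic functions. -/
def merCoord (q : ℂ) {N : ℕ} (i : Fin N) : Mer N := algebraMap (Entire N) (Mer N) (qpowCoord q i)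

theorem merCoord_ne_zero (q : ℂ) (i : Fin N) : merCoord q i ≠ 0 := by
  intro h0
  have h : qpowCoord q i = 0 :=
    IsFractionRing.injective (Entire N) (Mer N) (h0.trans (map_zero _).symm)
  exact Complex.exp_ne_zero _ (congrFun (congrArg Subtype.val h) 0)

theorem merCoord_injective (hq : q ≠ 0) (hq2 : q ^ 2 ≠ 1) :
    Function.Injective (merCoord q : Fin N → Mer N) := by
  intro i j hij
  by_contra hne
  have h1 : qpowCoord q i = qpowCoord q j := IsFractionRing.injective (Entire N) (Mer N) hij
  -- At the point `e_i` the two functions take the values `q⁻²` and `1`.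
  have h2 : Complex.exp _ = Complex.exp _ := congrFun (congrArg Subtype.val h1) (Pi.single i 1)
  rw [Pi.single_eq_same, Pi.single_eq_of_ne (Ne.symm hne), mul_one, exp_neg_two_mul_log hq] at h2
  simp at h2
  exact hq2 (by simpa using h2)

/-- This puts `h` in the shape of the symmetrization identity, with `s = q⁻²`. -/
theorem h_eq_merCoord (q : ℂ) (i j : Fin N) :
    h q i j = algebraMap ℂ (Mer N) q *
      ((merCoord q i - algebraMap ℂ (Mer N) (q⁻¹ ^ 2) * merCoord q j) /
        (merCoord q i - merCoord q j)) := by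
  have h1 : algebraMap (Entire N) (Mer N) (qpow q i j) = merCoord q i / merCoord q j := by
    rw [eq_div_iff (merCoord_ne_zero q j), merCoord, ← map_mul, qpow_mul_qpowCoord, merCoord]
  have := merCoord_ne_zero q j
  rw [h, h1, mul_div_assoc]
  congr 1
  rw [← mul_div_mul_right _ _ this, sub_mul, sub_mul, div_mul_cancel₀ _ this, one_mul]

theorem mul_div_add_mul_div_swap {K : Type} [Field K] (a : ℂ →+* K) (hq : q ≠ 0) {x y : K}
    (h1 : x - y ≠ 0) :
    a q * ((x - a (q⁻¹ ^ 2) * y) / (x - y)) + a q * ((y - a (q⁻¹ ^ 2) * x) / (y - x)) =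
      a (q + q⁻¹) := by
  have h3 : a q ≠ 0 := by simpa using hq
  have h4 : (y - x)⁻¹ = -(x - y)⁻¹ := by rw [← inv_neg, neg_sub]
  rw [map_add, map_pow, map_inv₀, div_eq_mul_inv, div_eq_mul_inv, h4]
  field_simp
  ring

/-- A constant has the same image under both moment maps, so this identity links left and right
weights. -/
theorem h_add_h (hq : q ≠ 0) (hq2 : q ^ 2 ≠ 1) {i j : Fin N} (hij : i ≠ j) :
    h q i j + h q j i = algebraMap ℂ (Mer N) (q + q⁻¹) := by
  have h1 : merCoord q i - merCoord q j ≠ 0 :=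
    sub_ne_zero.2 fun h => hij (merCoord_injective hq hq2 h)
  rw [h_eq_merCoord, h_eq_merCoord]
  exact mul_div_add_mul_div_swap (algebraMap ℂ (Mer N)) hq h1

theorem h_ne_zero (hq : q ≠ 0) (hq2 : q ^ 2 ≠ 1) (i j : Fin N) (hij : i ≠ j) : h q i j ≠ 0 := by
  rw [h_eq_merCoord]
  have h1 : merCoord q i - merCoord q j ≠ 0 :=
    sub_ne_zero.2 fun h => hij (merCoord_injective hq hq2 h)
  refine mul_ne_zero (by simpa using hq) (div_ne_zero (fun h0 => ?_) h1)
  rw [IsScalarTower.algebraMap_apply ℂ (Entire N) (Mer N), merCoord, merCoord, ← map_mul,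
    sub_eq_zero] at h0
  -- At the origin a vanishing numerator would give `1 = q⁻²`.
  have h2 : Complex.exp _ = q⁻¹ ^ 2 * Complex.exp _ :=
    congrFun (congrArg Subtype.val (IsFractionRing.injective (Entire N) (Mer N) h0)) 0
  simp at h2
  refine hq2 ?_
  rcases h2 with h | h <;> simp [h]

theorem T_algebraMap (α : Fin N → ℂ) (f : Entire N) :
    T α (algebraMap (Entire N) (Mer N) f) = algebraMap (Entire N) (Mer N) (shiftEntire α f) := by
  simp [T]

theorem T_ω_h (i j k : Fin N) (hki : k ≠ i) (hkj : k ≠ j) : T (ω k) (h q i j) = h q i j := by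
  have h1 : shiftEntire (ω k) (qpow q i j) = qpow q i j := by
    ext x
    change Complex.exp _ = Complex.exp _
    simp [ω, Pi.single_eq_of_ne hki.symm, Pi.single_eq_of_ne hkj.symm]
  rw [h, map_div₀, map_mul, map_sub, map_sub, T_algebraMap, h1, map_one, AlgEquiv.commutes,
    AlgEquiv.commutes]

/-- The symmetrization identity with `s = q⁻²` and `c = -q`; the numerators `1 - q^(-2(k+1))` vanish
only at roots of unity. -/
theorem sum_perm_prod_h (hq : q ≠ 0) (hroot : ∀ m : ℕ, 0 < m → q ^ m ≠ 1) :
    ∃ c : ℂ, c ≠ 0 ∧ ∑ σ : Equiv.Perm (Fin N), ∏ p : Fin N × Fin N with p.1 < p.2,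
      -h q (σ p.1) (σ p.2) = algebraMap ℂ (Mer N) c := by
  have hq2 := hroot 2 two_pos
  have hne : ∀ k : ℕ, 1 - (q⁻¹ ^ 2) ^ (k + 1) ≠ 0 := by
    intro k
    rw [sub_ne_zero, ← pow_mul, inv_pow]
    exact fun h => hroot _ (by omega) (inv_eq_one.1 h.symm)
  refine ⟨∏ k ∈ Finset.range N, (-q) ^ k * ((1 - (q⁻¹ ^ 2) ^ (k + 1)) / (1 - q⁻¹ ^ 2)), ?_, ?_⟩
  · refine Finset.prod_ne_zero_iff.2 fun k _ => mul_ne_zero (pow_ne_zero _ (neg_ne_zero.2 hq))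
      (div_ne_zero (hne k) ?_)
    simpa using hne 0
  · simp only [map_prod, map_mul, map_pow, map_div₀, map_sub, map_one, map_neg]
    rw [← sum_perm_prod_div _ _ (merCoord q) (merCoord_injective hq hq2) (merCoord_ne_zero q)]
    · simp only [h_eq_merCoord, neg_mul, map_pow]
    · intro h
      apply hne 0
      rw [sub_eq_zero, zero_add, pow_one]
      apply (algebraMap ℂ (Mer N)).injective
      rw [map_one, map_pow]
      exact h.symm

end Coefficients

/-! ### Generalized minors in the dynamical quantum matrix algebra -/

namespace FR

variable {q : ℂ} {N : ℕ}

/-- The quotient map onto `F_R(M(N))`. -/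
def mk (q : ℂ) (N : ℕ) : FreeAlgebra ℂ (FGen N) →ₐ[ℂ] FR q N := RingQuot.mkAlgHom ℂ (FRel q N)

theorem mk_rel {x y : FreeAlgebra ℂ (FGen N)} (hxy : FRel q N x y) : mk q N x = mk q N y :=
  RingQuot.mkAlgHom_rel ℂ hxy

theorem μl_algebraMap (c : ℂ) : μl q (algebraMap ℂ (Mer N) c) = algebraMap ℂ (FR q N) c :=
  (mk_rel (FRel.l_const c)).trans ((mk q N).commutes c)

theorem μr_algebraMap (c : ℂ) : μr q (algebraMap ℂ (Mer N) c) = algebraMap ℂ (FR q N) c :=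
  (mk_rel (FRel.r_const c)).trans ((mk q N).commutes c)

/-- The left moment map as a ring homomorphism. -/
def μlHom (q : ℂ) (N : ℕ) : Mer N →+* FR q N where
  toFun := μl q
  map_one' := by rw [← map_one (algebraMap ℂ (Mer N)), μl_algebraMap, map_one]
  map_zero' := by rw [← map_zero (algebraMap ℂ (Mer N)), μl_algebraMap, map_zero]
  map_mul' f f' := (mk_rel (FRel.l_mul f f')).trans (map_mul (mk q N) _ _)
  map_add' f f' := (mk_rel (FRel.l_add f f')).trans (map_add (mk q N) _ _)

/-- The right moment map as a ring homomorphism. -/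
def μrHom (q : ℂ) (N : ℕ) : Mer N →+* FR q N where
  toFun := μr q
  map_one' := by rw [← map_one (algebraMap ℂ (Mer N)), μr_algebraMap, map_one]
  map_zero' := by rw [← map_zero (algebraMap ℂ (Mer N)), μr_algebraMap, map_zero]
  map_mul' f f' := (mk_rel (FRel.r_mul f f')).trans (map_mul (mk q N) _ _)
  map_add' f f' := (mk_rel (FRel.r_add f f')).trans (map_add (mk q N) _ _)

theorem μlHom_apply (f : Mer N) : μlHom q N f = μl q f := rfl

theorem μrHom_apply (f : Mer N) : μrHom q N f = μr q f := rfl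

theorem commute_μl_μr (f f' : Mer N) : Commute (μlHom q N f) (μrHom q N f') := by
  have := mk_rel (q := q) (FRel.lr_comm f f')
  rwa [map_mul, map_mul] at this

theorem μl_mul_t (f : Mer N) (i j : Fin N) :
    μlHom q N f * t q i j = t q i j * μlHom q N (T (ω i) f) := by
  have := mk_rel (q := q) (FRel.l_shift f i j)
  rwa [map_mul, map_mul] at this

theorem μr_mul_t (f : Mer N) (i j : Fin N) :
    μrHom q N f * t q i j = t q i j * μrHom q N (T (ω j) f) := by
  have := mk_rel (q := q) (FRel.r_shift f i j)
  rwa [map_mul, map_mul] at this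

theorem t_mul_t_row (i : Fin N) {k l : Fin N} (hkl : k < l) :
    t q i l * t q i k = μrHom q N (h q k l) * (t q i k * t q i l) := by
  have := mk_rel (q := q) (FRel.row i k l hkl)
  rw [map_mul, map_mul, map_mul, mul_assoc] at this
  exact this.symm

theorem t_mul_t_col {i j : Fin N} (k : Fin N) (hij : i < j) :
    t q i k * t q j k = μlHom q N (h q j i) * (t q j k * t q i k) := by
  have := mk_rel (q := q) (FRel.col i j k hij)
  rw [map_mul, map_mul, map_mul, mul_assoc] at this
  exact this.symm

theorem t_mul_t_cross₁ {i j k l : Fin N} (hij : i < j) (hkl : k < l) :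
    t q i k * t q j l = t q j l * t q i k +
      (μlHom q N (h q j i) - μrHom q N (h q k l)) * (t q j k * t q i l) := by
  have := mk_rel (q := q) (FRel.cross₁ i j k l hij hkl)
  simp only [map_mul, map_add, map_sub, mul_assoc] at this
  exact this

theorem t_mul_t_cross₃ {i j k l : Fin N} (hij : i < j) (hkl : k < l) :
    t q i l * t q j k = μrHom q N (h q k l) * (μrHom q N (h q l k) * (t q j k * t q i l)) -
      (μlHom q N (h q i j) - μrHom q N (h q k l)) * (t q j l * t q i k) := by
  have := mk_rel (q := q) (FRel.cross₃ i j k l hij hkl)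
  simp only [map_mul, map_add, map_sub, mul_assoc] at this
  have hg : mk q N (FGen.R (g q k l)) = μrHom q N (h q k l) * μrHom q N (h q l k) := by
    rw [← map_mul]; rfl
  rw [hg, mul_assoc] at this
  exact eq_sub_of_add_eq this.symm

theorem μl_h_add (hq : q ≠ 0) (hq2 : q ^ 2 ≠ 1) {i j k l : Fin N} (hij : i ≠ j) (hkl : k ≠ l) :
    μlHom q N (h q i j) =
      μrHom q N (h q k l) + μrHom q N (h q l k) - μlHom q N (h q j i) := by
  rw [eq_sub_iff_add_eq, ← RingHom.map_add, ← RingHom.map_add, h_add_h hq hq2 hij,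
    h_add_h hq hq2 hkl]
  exact (μl_algebraMap _).trans (μr_algebraMap _).symm

theorem exchange_rows (hq : q ≠ 0) (hq2 : q ^ 2 ≠ 1) :
    Exchange (μlHom q N) (μrHom q N) (h q) (t q) where
  ne_zero := h_ne_zero hq hq2
  comm := commute_μl_μr
  comm_row i j k x hki hkj := by rw [Commute, SemiconjBy, μl_mul_t, T_ω_h _ _ _ hki hkj]
  comm_col i j k x hki hkj := by rw [Commute, SemiconjBy, μr_mul_t, T_ω_h _ _ _ hki hkj]
  shift f x := by
    obtain ⟨f', rfl⟩ := (T (ω x)).surjective f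
    exact ⟨f', fun i => (μr_mul_t _ _ _).symm⟩
  col i j x hij := t_mul_t_col x hij
  cross i j x y hij hxy := by
    -- Once `μl_h_add` eliminates the left copy of `h q i j`, the two sides differ by a commutator
    -- of right scalars times `t q j x * t q i y`.
    rw [t_mul_t_cross₁ hij hxy, t_mul_t_cross₃ hij hxy, μl_h_add hq hq2 hij.ne hxy.ne]
    have h1 : Commute (μrHom q N (h q x y)) (μrHom q N (h q y x)) := (Commute.all _ _).map _
    rw [← sub_eq_zero]
    refine Eq.trans (b := (μrHom q N (h q x y) * μrHom q N (h q y x) -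
      μrHom q N (h q y x) * μrHom q N (h q x y)) * (t q j x * t q i y)) (by noncomm_ring) ?_
    rw [h1.eq, sub_self, zero_mul]

/-- The order must be reversed: for increasing indices the row relation carries `h q k l` where the
column relation carries `h q j i`. -/
theorem exchange_cols (hq : q ≠ 0) (hq2 : q ^ 2 ≠ 1) :
    Exchange (μrHom q N) (μlHom q N) (weightDual (h q)) (transposeDual (t q)) where
  ne_zero i j hij := h_ne_zero hq hq2 _ _ hij
  comm f f' := (commute_μl_μr f' f).symm
  comm_row i j k x hki hkj := by
    rw [Commute, SemiconjBy, transposeDual, weightDual, μr_mul_t, T_ω_h]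
    exacts [hki, hkj]
  comm_col i j k x hki hkj := by
    rw [Commute, SemiconjBy, transposeDual, weightDual, μl_mul_t, T_ω_h]
    exacts [hki, hkj]
  shift f x := by
    obtain ⟨f', rfl⟩ := (T (ω (OrderDual.ofDual x))).surjective f
    exact ⟨f', fun i => (μl_mul_t _ _ _).symm⟩
  col i j x hij := t_mul_t_row _ hij
  cross i j x y hij hxy := by
    obtain ⟨i, rfl⟩ := OrderDual.toDual.surjective i
    obtain ⟨j, rfl⟩ := OrderDual.toDual.surjective j
    obtain ⟨x, rfl⟩ := OrderDual.toDual.surjective x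
    obtain ⟨y, rfl⟩ := OrderDual.toDual.surjective y
    rw [OrderDual.toDual_lt_toDual] at hij hxy
    simp only [transposeDual, weightDual, OrderDual.ofDual_toDual]
    rw [t_mul_t_cross₁ hxy hij, t_mul_t_cross₃ hxy hij, μl_h_add hq hq2 hxy.ne hij.ne]
    have h1 : Commute (μrHom q N (h q j i)) (μrHom q N (h q i j)) := (Commute.all _ _).map _
    have h2 := commute_μl_μr (q := q) (h q x y) (h q j i)
    rw [← sub_eq_zero]
    refine Eq.trans (b := ((μrHom q N (h q j i) * μrHom q N (h q i j) -
      μrHom q N (h q i j) * μrHom q N (h q j i)) + (μlHom q N (h q x y) * μrHom q N (h q j i) -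
      μrHom q N (h q j i) * μlHom q N (h q x y))) * (t q x j * t q y i)) (by noncomm_ring) ?_
    rw [h1.eq, h2.eq, sub_self, sub_self, add_zero, zero_mul]

/-- The bijection `p ↦ σ (N + 1 - p)`, with values in the indices in the opposite order. -/
def revDual {N : ℕ} : Equiv.Perm (Fin N) ≃ (Fin N ≃ (Fin N)ᵒᵈ) :=
  Fin.revPerm.equivCongr OrderDual.toDual

theorem revDual_apply (σ : Equiv.Perm (Fin N)) (k : Fin N) :
    revDual σ k = OrderDual.toDual (σ k.rev) := rfl

theorem revDual_one_strictMono : StrictMono (revDual (1 : Equiv.Perm (Fin N))) := by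
  intro a b hab
  rw [revDual_apply, revDual_apply, OrderDual.toDual_lt_toDual]
  exact Fin.rev_lt_rev.2 hab

/-- Reversing both positions and values preserves inversions but interchanges the two entries of
each, which turns the convention of `S` into that of `Stilde`. -/
theorem invWeight_revDual (σ : Equiv.Perm (Fin N)) :
    invWeight (weightDual (h q)) (revDual σ) = Stilde q σ id := by
  refine Finset.prod_bij' (fun p _ => (p.2.rev, p.1.rev)) (fun p _ => (p.2.rev, p.1.rev))
    ?_ ?_ ?_ ?_ ?_
  · intro p hp
    simpa [revDual_apply, Fin.rev_lt_rev] using hp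
  · intro p hp
    simpa [revDual_apply, Fin.rev_lt_rev] using hp
  · intro p _; simp
  · intro p _; simp
  · intro p _; rfl

open Exchange in
/-- The determinants as an alternating sum over the rows and over the columns agree. -/
theorem altSum_rows_eq_altSum_cols (hq : q ≠ 0) (hroot : ∀ m : ℕ, 0 < m → q ^ m ≠ 1) :
    altSum (μlHom q N) (h q) (t q) (1 : Equiv.Perm (Fin N)) =
      altSum (μrHom q N) (weightDual (h q)) (transposeDual (t q))
        (revDual (1 : Equiv.Perm (Fin N))) := by
  have hq2 := hroot 2 two_pos
  obtain ⟨c, hc, hsum⟩ := sum_perm_prod_h (N := N) hq hroot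
  have h3 := (exchange_rows (N := N) hq hq2).sum_mul_altSum_eq (exchange_cols (N := N) hq hq2)
    (τ₀ := (1 : Equiv.Perm (Fin N))) strictMono_id revDual_one_strictMono
  -- The factor is a complex number, so both moment maps send it to the same scalar, which is then
  -- cancelled.
  rw [hsum, μlHom_apply, μrHom_apply, μl_algebraMap, μr_algebraMap] at h3
  have h5 := congrArg (algebraMap ℂ (FR q N) c⁻¹ * ·) h3
  simpa only [← mul_assoc, ← map_mul, inv_mul_cancel₀ hc, map_one, one_mul] using h5

/-- The alternating sum over the columns, for a sequence `x` of rows. -/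
def colSum (q : ℂ) {N M : ℕ} (x : Fin M → (Fin N)ᵒᵈ) : FR q N :=
  Exchange.altSum (μrHom q N) (weightDual (h q)) (transposeDual (t q)) x

theorem colSum_eq_zero (hq : q ≠ 0) (hq2 : q ^ 2 ≠ 1) {M : ℕ} {x : Fin M → (Fin N)ᵒᵈ}
    (hx : ¬Function.Injective x) : colSum q x = 0 :=
  (exchange_cols (N := N) hq hq2).altSum_eq_zero hx

/-- The two by two minor with rows `p` and columns `i < j`. -/
def minorTwo (q : ℂ) {N : ℕ} (i j : Fin N) (p : Fin N × Fin N) : FR q N :=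
  Exchange.pairMinor (μrHom q N) (weightDual (h q)) (transposeDual (t q))
    (OrderDual.toDual j) (OrderDual.toDual i) (OrderDual.toDual p.2) (OrderDual.toDual p.1)

theorem colSum_laplace (hq : q ≠ 0) (hq2 : q ^ 2 ≠ 1) {n : ℕ} (x : Fin (2 * n) → (Fin N)ᵒᵈ) :
    ∑ σ : Fin (2 * n) ≃ (Fin N)ᵒᵈ with
        ∀ k : Fin n, σ ⟨2 * k, by omega⟩ < σ ⟨2 * k + 1, by omega⟩,
      μr q (invWeight (weightDual (h q)) σ) * (List.ofFn fun k : Fin n =>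
        minorTwo q (OrderDual.ofDual (σ ⟨2 * k + 1, by omega⟩))
          (OrderDual.ofDual (σ ⟨2 * k, by omega⟩))
          (OrderDual.ofDual (x ⟨2 * k + 1, by omega⟩),
            OrderDual.ofDual (x ⟨2 * k, by omega⟩))).prod = colSum q x :=
  (exchange_cols (N := N) hq hq2).altSum_laplace x

/-- The prefactor `S(ρ)⁻¹` cancels the column sign from `altSum_equiv`, hence the independence of
`ρ`. -/
theorem det_eq_colSum (hq : q ≠ 0) (hroot : ∀ m : ℕ, 0 < m → q ^ m ≠ 1)
    (ρ : Equiv.Perm (Fin N)) :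
    det q N ρ = colSum q (revDual (1 : Equiv.Perm (Fin N))) := by
  have hq2 := hroot 2 two_pos
  have H := exchange_rows (N := N) hq hq2
  have h1 := H.altSum_equiv (τ₀ := 1) strictMono_id ρ
  rw [colSum, ← altSum_rows_eq_altSum_cols hq hroot]
  have h2 : det q N ρ = μrHom q N (invWeight (h q) ρ)⁻¹ *
    Exchange.altSum (μlHom q N) (h q) (t q) ρ := rfl
  rw [h2, h1, ← mul_assoc, ← RingHom.map_mul, inv_mul_cancel₀ (invWeight_ne_zero H.ne_zero ρ),
    RingHom.map_one, one_mul]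

theorem colSum_revDual (hq : q ≠ 0) (hroot : ∀ m : ℕ, 0 < m → q ^ m ≠ 1)
    (ρ τ : Equiv.Perm (Fin N)) :
    colSum q (revDual τ) =
      μl q (Stilde q τ id) * det q N ρ := by
  have h1 := (exchange_cols (N := N) hq (hroot 2 two_pos)).altSum_equiv revDual_one_strictMono
    (revDual τ)
  rw [colSum, h1, det_eq_colSum hq hroot ρ, invWeight_revDual]
  rfl

/-- For two by two minors the row and column expansions agree directly by `cross₁`, without
symmetrization. The other choice of `ρ` is reduced to the identity by the exchange relation. -/
theorem minor_two (hq : q ≠ 0) (hq2 : q ^ 2 ≠ 1) (ρ : Equiv.Perm (Fin 2)) {k l i j : Fin N}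
    (hkl : k < l) (hij : i < j) :
    minor q ρ ![k, l] ![i, j] = minorTwo q i j (k, l) := by
  have huniv : (Finset.univ : Finset (Equiv.Perm (Fin 2))) = {1, Equiv.swap 0 1} := by decide
  have hS1 : ∀ I : Fin 2 → Fin N, S q 1 I = 1 := fun I => by
    rw [S, Finset.filter_eq_empty_iff.2, Finset.prod_empty]
    decide
  have hS2 : ∀ I : Fin 2 → Fin N, S q (Equiv.swap 0 1) I = -h q (I 1) (I 0) := fun I => by
    have : (Finset.univ.filter fun p : Fin 2 × Fin 2 => p.1 < p.2 ∧
      Equiv.swap (0 : Fin 2) 1 p.2 < Equiv.swap (0 : Fin 2) 1 p.1) = {(0, 1)} := by decide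
    rw [S, this]
    simp
  have hne : (1 : Equiv.Perm (Fin 2)) ≠ Equiv.swap 0 1 := by decide
  have hρ : ρ = 1 ∨ ρ = Equiv.swap 0 1 := by
    have := Finset.mem_univ ρ
    rw [huniv] at this
    simpa using this
  have hsum : ∀ F : Equiv.Perm (Fin 2) → FR q N, ∑ σ, F σ = F 1 + F (Equiv.swap 0 1) := fun F => by
    rw [huniv, Finset.sum_pair hne]
  have h1 : t q k i * t q l j - μlHom q N (h q l k) * (t q l i * t q k j) =
      t q l j * t q k i - μrHom q N (h q i j) * (t q l i * t q k j) := by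
    rw [t_mul_t_cross₁ hkl hij]
    noncomm_ring
  have h2 := (exchange_rows (N := N) hq hq2).cross k l i j hkl hij
  have h3 : -h q j i ≠ 0 := neg_ne_zero.2 (h_ne_zero hq hq2 _ _ hij.ne')
  change _ = t q l j * t q k i - μrHom q N (h q i j) * (t q l i * t q k j)
  rw [minor, hsum, hS1, hS2, ← μrHom_apply, ← μlHom_apply, ← μlHom_apply, map_one, one_mul]
  rcases hρ with rfl | rfl
  · rw [hS1, inv_one, map_one, one_mul, ← h1]
    simp [sub_eq_add_neg]
  · rw [hS2, ← h1]
    have h4 : μrHom q N (-h q j i)⁻¹ * (t q k j * t q l i -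
        μlHom q N (h q l k) * (t q l j * t q k i)) =
        t q k i * t q l j - μlHom q N (h q l k) * (t q l i * t q k j) := by
      rw [h2, ← RingHom.map_neg, ← mul_assoc, ← RingHom.map_mul, inv_mul_cancel₀ h3,
        RingHom.map_one, one_mul]
    rw [← h4]
    simp [sub_eq_add_neg]

end FR

/-! ### The product on `B̃ ⊗̃ F_R(M(N))` -/

namespace BF

variable {q : ℂ} {N : ℕ}

/-- The quotient map onto `B̃ ⊗̃ F_R(M(N))`. -/
def mk (q : ℂ) (N : ℕ) : matched q N →ₐ[ℂ] BF q N := RingQuot.mkAlgHom ℂ (TRel q N)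

open Classical in
/-- The element `b ⊗ a`, and `0` if the weights of `b` and `a` do not match. -/
def tm (q : ℂ) {N : ℕ} (b : Bt N) (a : FR q N) : BF q N :=
  if hba : b ⊗ₜ[ℂ] a ∈ matched q N then mk q N ⟨b ⊗ₜ a, hba⟩ else 0

theorem tm_of_mem {b : Bt N} {a : FR q N} (hba : b ⊗ₜ[ℂ] a ∈ matched q N) :
    tm q b a = mk q N ⟨b ⊗ₜ a, hba⟩ := dif_pos hba

theorem tmul_mem_matched {α β : Fin N → ℕ} {b : Bt N} {a : FR q N} (hb : b ∈ Bt.comp α)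
    (ha : a ∈ FR.comp q α β) : b ⊗ₜ[ℂ] a ∈ matched q N :=
  Algebra.subset_adjoin ⟨α, β, b, hb, a, ha, rfl⟩

theorem tmul_eq_tm {α β : Fin N → ℕ} (b : Bt N) (a : FR q N) (hb : b ∈ Bt.comp α)
    (ha : a ∈ FR.comp q α β) : tmul b a hb ha = tm q b a :=
  (tm_of_mem (tmul_mem_matched hb ha)).symm

theorem mul_tmul_mul_mem {b b' : Bt N} {a a' : FR q N} (hba : b ⊗ₜ[ℂ] a ∈ matched q N)
    (hba' : b' ⊗ₜ[ℂ] a' ∈ matched q N) : (b * b') ⊗ₜ[ℂ] (a * a') ∈ matched q N := by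
  rw [← Algebra.TensorProduct.tmul_mul_tmul]
  exact mul_mem hba hba'

theorem tm_mul_tm {b b' : Bt N} {a a' : FR q N} (hba : b ⊗ₜ[ℂ] a ∈ matched q N)
    (hba' : b' ⊗ₜ[ℂ] a' ∈ matched q N) : tm q b a * tm q b' a' = tm q (b * b') (a * a') := by
  rw [tm_of_mem hba, tm_of_mem hba', tm_of_mem (mul_tmul_mul_mem hba hba'), ← map_mul]
  congr 1
  exact Subtype.ext (Algebra.TensorProduct.tmul_mul_tmul _ _ _ _)

theorem one_tmul_one_mem : (1 : Bt N) ⊗ₜ[ℂ] (1 : FR q N) ∈ matched q N := by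
  rw [← Algebra.TensorProduct.one_def]
  exact one_mem _

theorem list_prod_tmul_mem : ∀ {r : ℕ} (b : Fin r → Bt N) (a : Fin r → FR q N),
    (∀ k, b k ⊗ₜ[ℂ] a k ∈ matched q N) →
    (List.ofFn b).prod ⊗ₜ[ℂ] (List.ofFn a).prod ∈ matched q N
  | 0, b, a, _ => by simpa using one_tmul_one_mem
  | r + 1, b, a, hba => by
    rw [List.ofFn_succ, List.prod_cons, List.ofFn_succ, List.prod_cons]
    exact mul_tmul_mul_mem (hba 0) (list_prod_tmul_mem _ _ fun k => hba k.succ)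

theorem list_prod_tm : ∀ {r : ℕ} (b : Fin r → Bt N) (a : Fin r → FR q N),
    (∀ k, b k ⊗ₜ[ℂ] a k ∈ matched q N) →
    (List.ofFn fun k => tm q (b k) (a k)).prod = tm q (List.ofFn b).prod (List.ofFn a).prod
  | 0, b, a, _ => by
    simp only [List.ofFn_zero, List.prod_nil]
    rw [tm_of_mem one_tmul_one_mem, ← map_one (mk q N)]
    rfl
  | r + 1, b, a, hba => by
    rw [List.ofFn_succ, List.prod_cons, list_prod_tm _ _ fun k => hba k.succ,
      tm_mul_tm (hba 0) (list_prod_tmul_mem _ _ fun k => hba k.succ), List.ofFn_succ,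
      List.prod_cons, List.ofFn_succ, List.prod_cons]

theorem tm_sum_right {κ : Type} (s : Finset κ) (b : Bt N) (a : κ → FR q N)
    (hba : ∀ k ∈ s, b ⊗ₜ[ℂ] a k ∈ matched q N) : tm q b (∑ k ∈ s, a k) = ∑ k ∈ s, tm q b (a k) := by
  have hmem : b ⊗ₜ[ℂ] (∑ k ∈ s, a k) ∈ matched q N := by
    rw [TensorProduct.tmul_sum]
    exact sum_mem hba
  rw [← Finset.sum_attach s fun k => tm q b (a k),
    Finset.sum_congr rfl fun (k : s) _ => tm_of_mem (hba k.1 k.2), ← map_sum, tm_of_mem hmem]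
  congr 1
  refine Subtype.ext ?_
  rw [AddSubmonoidClass.coe_finsetSum]
  exact (TensorProduct.tmul_sum _ _ _).trans (Finset.sum_attach s fun k => b ⊗ₜ[ℂ] a k).symm

theorem tm_sum_left {κ : Type} (s : Finset κ) (b : κ → Bt N) (a : FR q N)
    (hba : ∀ k ∈ s, b k ⊗ₜ[ℂ] a ∈ matched q N) : tm q (∑ k ∈ s, b k) a = ∑ k ∈ s, tm q (b k) a := by
  have hmem : (∑ k ∈ s, b k) ⊗ₜ[ℂ] a ∈ matched q N := by
    rw [TensorProduct.sum_tmul]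
    exact sum_mem hba
  rw [← Finset.sum_attach s fun k => tm q (b k) a,
    Finset.sum_congr rfl fun (k : s) _ => tm_of_mem (hba k.1 k.2), ← map_sum, tm_of_mem hmem]
  congr 1
  refine Subtype.ext ?_
  rw [AddSubmonoidClass.coe_finsetSum]
  exact (TensorProduct.sum_tmul _ _ _).trans (Finset.sum_attach s fun k => b k ⊗ₜ[ℂ] a).symm

theorem tm_μl_mul (f : Mer N) {α β : Fin N → ℕ} {b : Bt N} {a : FR q N} (hb : b ∈ Bt.comp α)
    (ha : a ∈ FR.comp q α β) : tm q b (FR.μl q f * a) = tm q (Bt.coeff f * b) a := by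
  have h1 := FR.mul_mem_comp (FR.μl_mem (q := q) f) ha
  have h2 := Bt.mul_mem_comp (Bt.coeff_mem f) hb
  rw [zero_add] at h2
  rw [zero_add, zero_add] at h1
  rw [tm_of_mem (tmul_mem_matched hb h1), tm_of_mem (tmul_mem_matched h2 ha)]
  exact RingQuot.mkAlgHom_rel ℂ (TRel.mk f α β b a hb ha _ _ rfl rfl)

theorem list_prod_sum {A κ : Type} [Ring A] [Algebra ℂ A] {r : ℕ} (s : Finset κ)
    (F : Fin r → κ → A) :
    (List.ofFn fun k => ∑ p ∈ s, F k p).prod =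
      ∑ f ∈ Fintype.piFinset fun _ : Fin r => s, (List.ofFn fun k => F k (f k)).prod := by
  have := (MultilinearMap.mkPiAlgebraFin ℂ r A).map_sum_finset F fun _ => s
  simpa only [MultilinearMap.mkPiAlgebraFin_apply] using this

end BF

/-! ### Expansion of the Pfaffian over sequences of pairs -/

namespace BF

variable {q : ℂ}

/-- The sequence of column indices attached to a sequence of pairs. -/
def interleave {n : ℕ} (f : Fin n → Fin (2 * n) × Fin (2 * n)) (m : Fin (2 * n)) :
    (Fin (2 * n))ᵒᵈ :=
  if (m : ℕ) % 2 = 0 then OrderDual.toDual (f ⟨m / 2, by omega⟩).2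
  else OrderDual.toDual (f ⟨m / 2, by omega⟩).1

theorem interleave_even {n : ℕ} (f : Fin n → Fin (2 * n) × Fin (2 * n)) (k : Fin n) :
    interleave f ⟨2 * k, by omega⟩ = OrderDual.toDual (f k).2 := by
  simp [interleave]

theorem interleave_odd {n : ℕ} (f : Fin n → Fin (2 * n) × Fin (2 * n)) (k : Fin n) :
    interleave f ⟨2 * k + 1, by omega⟩ = OrderDual.toDual (f k).1 := by
  have h1 : (2 * (k : ℕ) + 1) / 2 = k := by omega
  simp [interleave, h1]

theorem ext_even_odd {n : ℕ} {X : Type} {x y : Fin (2 * n) → X}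
    (h0 : ∀ k : Fin n, x ⟨2 * k, by omega⟩ = y ⟨2 * k, by omega⟩)
    (h1 : ∀ k : Fin n, x ⟨2 * k + 1, by omega⟩ = y ⟨2 * k + 1, by omega⟩) : x = y := by
  funext m
  rcases Nat.even_or_odd' (m : ℕ) with ⟨k, hk | hk⟩
  · have := h0 ⟨k, by omega⟩
    rwa [show m = ⟨2 * k, by omega⟩ from Fin.ext hk]
  · have := h1 ⟨k, by omega⟩
    rwa [show m = ⟨2 * k + 1, by omega⟩ from Fin.ext hk]

theorem rev_even {n : ℕ} (k : Fin n) :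
    (⟨2 * k, by omega⟩ : Fin (2 * n)).rev = ⟨2 * (k.rev : ℕ) + 1, by omega⟩ := by
  ext
  simp only [Fin.val_rev]
  omega

theorem rev_odd {n : ℕ} (k : Fin n) :
    (⟨2 * k + 1, by omega⟩ : Fin (2 * n)).rev = ⟨2 * (k.rev : ℕ), by omega⟩ := by
  ext
  simp only [Fin.val_rev]
  omega

/-- The permutations over which the tilde Pfaffian is summed. -/
abbrev pairPerms (n : ℕ) : Finset (Equiv.Perm (Fin (2 * n))) :=
  Finset.univ.filter fun σ => ∀ k : Fin n, σ ⟨2 * k, by omega⟩ < σ ⟨2 * k + 1, by omega⟩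

/-- The sequences of pairs of increasing indices. -/
abbrev pairSeqs (n : ℕ) : Finset (Fin n → Fin (2 * n) × Fin (2 * n)) :=
  Fintype.piFinset fun _ => Finset.univ.filter fun p => p.1 < p.2

/-- The sequence of pairs attached to a permutation. -/
def pairsOf {n : ℕ} (τ : Equiv.Perm (Fin (2 * n))) (k : Fin n) : Fin (2 * n) × Fin (2 * n) :=
  (τ ⟨2 * (k.rev : ℕ), by omega⟩, τ ⟨2 * (k.rev : ℕ) + 1, by omega⟩)

/-- The Pfaffian multiplies its pairs from last to first, and `interleave` lists the larger index of
each pair first; together these are the reversal in `revDual`. -/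
theorem interleave_pairsOf {n : ℕ} (τ : Equiv.Perm (Fin (2 * n))) :
    interleave (pairsOf τ) = FR.revDual τ := by
  refine ext_even_odd (fun k => ?_) fun k => ?_
  · rw [interleave_even, FR.revDual_apply, rev_even]; rfl
  · rw [interleave_odd, FR.revDual_apply, rev_odd]; rfl

theorem pairsOf_injective {n : ℕ} :
    Function.Injective (pairsOf : Equiv.Perm (Fin (2 * n)) → _) := by
  intro τ τ' hττ
  have := congrArg interleave hττ
  rw [interleave_pairsOf, interleave_pairsOf] at this
  exact FR.revDual.injective (DFunLike.coe_injective this)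

theorem pairsOf_mem {n : ℕ} {τ : Equiv.Perm (Fin (2 * n))} (hτ : τ ∈ pairPerms n) :
    pairsOf τ ∈ pairSeqs n := by
  simp only [Fintype.mem_piFinset, Finset.mem_filter, Finset.mem_univ, true_and] at hτ ⊢
  exact fun k => hτ k.rev

theorem exists_pairsOf_eq {n : ℕ} {f : Fin n → Fin (2 * n) × Fin (2 * n)} (hf : f ∈ pairSeqs n)
    (hinj : Function.Injective (interleave f)) : ∃ τ ∈ pairPerms n, pairsOf τ = f := by
  let e : Fin (2 * n) ≃ (Fin (2 * n))ᵒᵈ := Equiv.ofBijective (interleave f)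
    ((Fintype.bijective_iff_injective_and_card _).2 ⟨hinj, by simp⟩)
  obtain ⟨τ, hτ⟩ := FR.revDual.surjective e
  have h1 : ∀ m, OrderDual.toDual (τ m.rev) = interleave f m := fun m =>
    DFunLike.congr_fun hτ m
  have h2 : pairsOf τ = f := by
    funext k
    have ha := h1 ⟨2 * k, by omega⟩
    have hb := h1 ⟨2 * k + 1, by omega⟩
    rw [interleave_even, rev_even] at ha
    rw [interleave_odd, rev_odd] at hb
    exact Prod.ext hb ha
  refine ⟨τ, ?_, h2⟩
  simp only [Fintype.mem_piFinset, Finset.mem_filter, Finset.mem_univ, true_and] at hf ⊢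
  intro k
  have := hf k.rev
  rw [← h2] at this
  simpa [pairsOf] using this

/-- The product of the generators of `B̃` attached to a sequence of pairs. -/
def bProd {n : ℕ} (f : Fin n → Fin (2 * n) × Fin (2 * n)) : Bt (2 * n) :=
  (List.ofFn fun k => Bt.b (f k).2 (f k).1).prod

theorem bProd_pairsOf_mem {n : ℕ} (τ : Equiv.Perm (Fin (2 * n))) :
    bProd (pairsOf τ) ∈ Bt.comp (∑ k : Fin (2 * n), Pi.single k 1) := by
  have h1 := Bt.list_prod_mem_comp _ _ fun k : Fin n =>
    Bt.b_mem (τ ⟨2 * (k.rev : ℕ) + 1, by omega⟩) (τ ⟨2 * (k.rev : ℕ), by omega⟩)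
  have h2 := Equiv.sum_comp Fin.revPerm (fun k : Fin n =>
      (Pi.single (τ ⟨2 * (k : ℕ), by omega⟩) 1 +
        Pi.single (τ ⟨2 * (k : ℕ) + 1, by omega⟩) 1 : Fin (2 * n) → ℕ))
  simp only [Fin.revPerm_apply] at h2
  rw [h2, Bt.sum_pairs n (fun m => (Pi.single (τ m) 1 : Fin (2 * n) → ℕ)),
    Equiv.sum_comp τ (fun m => (Pi.single m 1 : Fin (2 * n) → ℕ))] at h1
  exact h1

open FR (minorTwo)

theorem b_tmul_minorTwo_mem {N : ℕ} (hq : q ≠ 0) (hq2 : q ^ 2 ≠ 1) {i j : Fin N}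
    {p : Fin N × Fin N} (hij : i < j) (hp : p.1 < p.2) :
    Bt.b p.2 p.1 ⊗ₜ[ℂ] minorTwo q i j p ∈ matched q N := by
  rw [← FR.minor_two hq hq2 1 hp hij]
  exact tmul_mem_matched (Bt.b_mem _ _) (minor_two_mem q 1 _ _ _ _)

theorem c_eq {N : ℕ} (hq : q ≠ 0) (hq2 : q ^ 2 ≠ 1)
    (ρ : Fin N → Fin N → Fin N → Fin N → Equiv.Perm (Fin 2)) {i j : Fin N} (hij : i < j) :
    c q ρ j i = ∑ p : Fin N × Fin N with p.1 < p.2, tm q (Bt.b p.2 p.1) (minorTwo q i j p) := by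
  refine Finset.sum_congr rfl fun p hp => ?_
  rw [tmul_eq_tm, FR.minor_two hq hq2 _ (Finset.mem_filter.1 hp).2 hij]

/-- The product of minors attached to a permutation of the columns and a sequence of pairs of
rows. -/
def minorProd (q : ℂ) {n : ℕ} (σ : Equiv.Perm (Fin (2 * n)))
    (f : Fin n → Fin (2 * n) × Fin (2 * n)) : FR q (2 * n) :=
  FR.μr q (Stilde q σ id) * (List.ofFn fun k : Fin n =>
    minorTwo q (σ ⟨2 * (k.rev : ℕ), by omega⟩) (σ ⟨2 * (k.rev : ℕ) + 1, by omega⟩) (f k)).prod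

theorem minorProd_mem {n : ℕ} (hq : q ≠ 0) (hq2 : q ^ 2 ≠ 1) {σ : Equiv.Perm (Fin (2 * n))}
    (hσ : σ ∈ pairPerms n) {f : Fin n → Fin (2 * n) × Fin (2 * n)} (hf : f ∈ pairSeqs n) :
    bProd f ⊗ₜ[ℂ] minorProd q σ f ∈ matched q (2 * n) := by
  have h1 := mul_tmul_mul_mem (tmul_mem_matched Bt.one_mem_comp (FR.μr_mem (Stilde q σ id)))
    (list_prod_tmul_mem _ _ fun k => b_tmul_minorTwo_mem hq hq2
      ((Finset.mem_filter.1 hσ).2 k.rev) (Finset.mem_filter.1 (Fintype.mem_piFinset.1 hf k)).2)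
  rwa [one_mul] at h1

theorem coeff_mul_prod_c {n : ℕ} (hq : q ≠ 0) (hq2 : q ^ 2 ≠ 1)
    (ρ : Fin (2 * n) → Fin (2 * n) → Fin (2 * n) → Fin (2 * n) → Equiv.Perm (Fin 2))
    {σ : Equiv.Perm (Fin (2 * n))} (hσ : σ ∈ pairPerms n) :
    coeff q (Stilde q σ id) * (List.ofFn fun k : Fin n =>
        c q ρ (σ ⟨2 * (k.rev : ℕ) + 1, by omega⟩) (σ ⟨2 * (k.rev : ℕ), by omega⟩)).prod =
      ∑ f ∈ pairSeqs n, tm q (bProd f) (minorProd q σ f) := by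
  have hσ' := (Finset.mem_filter.1 hσ).2
  have h1 : (fun k : Fin n =>
      c q ρ (σ ⟨2 * (k.rev : ℕ) + 1, by omega⟩) (σ ⟨2 * (k.rev : ℕ), by omega⟩)) = fun k =>
      ∑ p : Fin (2 * n) × Fin (2 * n) with p.1 < p.2, tm q (Bt.b p.2 p.1)
        (minorTwo q (σ ⟨2 * (k.rev : ℕ), by omega⟩) (σ ⟨2 * (k.rev : ℕ) + 1, by omega⟩) p) :=
    funext fun k => c_eq hq hq2 ρ (hσ' k.rev)
  rw [h1, list_prod_sum, Finset.mul_sum]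
  refine Finset.sum_congr rfl fun f hf => ?_
  have h2 : ∀ k, Bt.b (f k).2 (f k).1 ⊗ₜ[ℂ] minorTwo q (σ ⟨2 * (k.rev : ℕ), by omega⟩)
      (σ ⟨2 * (k.rev : ℕ) + 1, by omega⟩) (f k) ∈ matched q (2 * n) := fun k =>
    b_tmul_minorTwo_mem hq hq2 (hσ' k.rev) (Finset.mem_filter.1 (Fintype.mem_piFinset.1 hf k)).2
  rw [list_prod_tm _ _ h2, coeff, tmul_eq_tm, tm_mul_tm
    (tmul_mem_matched Bt.one_mem_comp (FR.μr_mem (Stilde q σ id))) (list_prod_tmul_mem _ _ h2),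
    one_mul]
  rfl

/-- Under `revDual` the set `Π` becomes the index set of the Laplace expansion, and `Stilde` becomes
its weight. -/
theorem sum_minorProd {n : ℕ} (hq : q ≠ 0) (hq2 : q ^ 2 ≠ 1)
    (f : Fin n → Fin (2 * n) × Fin (2 * n)) :
    ∑ σ ∈ pairPerms n, minorProd q σ f =
      FR.colSum q (interleave f) := by
  rw [← FR.colSum_laplace hq hq2]
  refine Finset.sum_equiv FR.revDual ?_ ?_
  · intro σ
    simp only [Finset.mem_filter, Finset.mem_univ, true_and, FR.revDual_apply, rev_even, rev_odd,
      OrderDual.toDual_lt_toDual]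
    refine ⟨fun hσ k => hσ k.rev, fun hσ k => ?_⟩
    simpa using hσ k.rev
  · intro σ _
    rw [FR.invWeight_revDual, minorProd]
    simp only [FR.revDual_apply, rev_even, rev_odd, interleave_even, interleave_odd]
    rfl

theorem tm_zero {N : ℕ} (b : Bt N) : tm q b 0 = 0 := by
  simpa using tm_sum_right (q := q) (κ := ℕ) ∅ b (fun _ => 0) (by simp)

theorem Pft_c_eq (n : ℕ) (hq : q ≠ 0) (hroot : ∀ m : ℕ, 0 < m → q ^ m ≠ 1)
    (ρ₂ : Fin (2 * n) → Fin (2 * n) → Fin (2 * n) → Fin (2 * n) → Equiv.Perm (Fin 2))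
    (ρ : Equiv.Perm (Fin (2 * n))) :
    Pft q n (coeff q) (c q ρ₂) = tm q (Bt.pf q n) (FR.det q (2 * n) ρ) := by
  have hq2 := hroot 2 two_pos
  have hdet : FR.det q (2 * n) ρ ∈ FR.comp q (∑ k, Pi.single k 1) (∑ k, Pi.single k 1) :=
    FR.minor_mem ρ id id
  rw [Pft, Finset.sum_congr rfl fun σ hσ => coeff_mul_prod_c hq hq2 ρ₂ hσ,
    Finset.sum_comm, Bt.pf, Pft]
  have h1 : ∀ f ∈ pairSeqs n, ∑ σ ∈ pairPerms n, tm q (bProd f) (minorProd q σ f) =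
      tm q (bProd f) (FR.colSum q (interleave f)) := fun f hf => by
    rw [← sum_minorProd hq hq2, tm_sum_right _ _ _ fun σ hσ => minorProd_mem hq hq2 hσ hf]
  rw [Finset.sum_congr rfl h1, tm_sum_left]
  · symm
    -- A sequence of pairs outside the image of `Π` repeats a row, so its column sum vanishes.
    refine Finset.sum_of_injOn pairsOf pairsOf_injective.injOn (fun τ hτ => pairsOf_mem hτ) ?_ ?_
    · intro f hf hf'
      rw [FR.colSum_eq_zero hq hq2, tm_zero]
      intro hinj
      obtain ⟨τ, hτ, rfl⟩ := exists_pairsOf_eq hf hinj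
      exact hf' ⟨τ, hτ, rfl⟩
    · intro τ _
      -- The row sign `S̃(τ)` comes out under `μ_l` and crosses the tensor sign, becoming the
      -- coefficient of the word of `τ` in the Pfaffian of `B̃`.
      rw [interleave_pairsOf, FR.colSum_revDual hq hroot ρ,
        tm_μl_mul _ (bProd_pairsOf_mem τ) hdet]
      rfl
  · intro τ _
    have h2 := Bt.mul_mem_comp (Bt.coeff_mem (Stilde q τ id)) (bProd_pairsOf_mem τ)
    rw [zero_add] at h2
    exact tmul_mem_matched h2 hdet

end BF

end DynPf

end

/-- For every `n`, every nonzero `q` that is not a root of unity and every choice of the permutations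
used to compute the minors, `P̃f(C) = P̃f(B̃) ⊗ det(T)` in `B̃ ⊗̃ F_R(M(2n))`. -/
theorem mainTheorem3 (n : ℕ) (q : ℂ) (hq : q ≠ 0) (hroot : ∀ m : ℕ, 0 < m → q ^ m ≠ 1)
    (ρ₂ : Fin (2 * n) → Fin (2 * n) → Fin (2 * n) → Fin (2 * n) → Equiv.Perm (Fin 2))
    (ρ : Equiv.Perm (Fin (2 * n))) :
    DynPf.Pft q n (DynPf.BF.coeff q) (DynPf.BF.c q ρ₂) =
      DynPf.BF.tmul (DynPf.Bt.pf q n) (DynPf.FR.det q (2 * n) ρ)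
        (DynPf.Bt.pf_mem q n) (DynPf.FR.minor_mem ρ id id) := by
  exact (DynPf.BF.Pft_c_eq n hq hroot ρ₂ ρ).trans (DynPf.BF.tmul_eq_tm _ _ _ _).symm
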